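/- **Conventions.** A tableau is a Young diagram filled with distinct positive integers that increase along rows (left to right) and down columns; the empty tableau is allowed. Write $T=(T_1,T_2,\ldots)$ for its columns, $\mathrm{sh}(T)=(\lambda_1(T),\lambda_2(T),\ldots)$ for the column lengths and $\omega_1(T)$ for the largest entry of $T_1$. Let $\mathbf T_n^2$ be the set of standard tableaux (entries $1,\dots,n$) with at most two columns. For a column $C$, $C+\{j\}$ and $C\setminus\{j\}$ are the columns obtained by adding, resp. deleting, the entry $j$ (empty columns are dropped). *Insertion.* $j\Rightarrow T$ is column insertion: $j$ replaces the smallest entry of $T_1$ greater than $j$, which is then inserted in the same way into $T_2$, and so on; if no entry of a column is greater, the inserted number is put at its bottom. For a word $w=[a_1,\dots,a_n]$ with distinct letters put $T(w)=a_1\Rightarrow(a_2\Rightarrow(\cdots\Rightarrow(a_n\Rightarrow\emptyset)))$. *Deletion.* For a corner entry $a$ of $T$, $T\Leftarrow a$ is obtained by deleting $a$ from its column and pushing it left through the previous columns: in each column the incoming number replaces the greatest entry smaller than it, and this entry moves on to the column to the left; the last one leaves the tableau. *Projection.* $\pi_{a,b}(T)$ is obtained from $T$ by removing by jeu de taquin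 the entries less than $a$ (smallest first) and the entries greater than $b$ (greatest first). *Orders.* Let $\le$ be either of the following two orders on tableaux with a given finite set of entries (they coincide on two-column tableaux). * Induced weak order: $T\le S$ if there is a sequence of tableaux $T=P_1,\dots,P_k=S$ such that for each $j<k$ there are words $w,y$ with $T(w)=P_j$, $T(y)=P_{j+1}$ and $w\le y$ in the right weak order (whenever $a<b$ and $b$ stands before $a$ in $w$, then $b$ stands before $a$ in $y$). * Chain order: $T\le S$ if $\mathrm{sh}(\pi_{a,b}(T))\le \mathrm{sh}(\pi_{a,b}(S))$ in the dominance order (comparing partial sums of column lengths) for all entries $a<b$. Put $T<S$ if $T\le S$ and $T\ne S$, and let $\mathcal D(T)$ (the cover of $T$) be the set of all $S>T$ such that there is no $P$ with $T<P<S$. **Proposition.** Let $T\in\mathbf T_n^2$. 1. If $n$ is in the first column of $T$, then $S>T$ if and only if $S=n\Rightarrow S'$ for some $S'>\pi_{1,n-1}(T)$. In particular, $$\mathcal D(T)=\{\,n\Rightarrow S' \;:\; S'\in\mathcal D(\pi_{1,n-1}(T))\,\}.$$ 2. If $n$ is in the second column of $T$, then $S>T$ if and only if either $S=n\Rightarrow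 S'$ for some $S'\ge\pi_{1,n-1}(T)$, or $S=\omega_1(T)\Rightarrow S'$ for some $S'>(T\Leftarrow n)$. In particular, $$\mathcal D(T)=\{\,\omega_1(T)\Rightarrow(n\Rightarrow S'') \;:\; S''\in\mathcal D(T_1\setminus\{\omega_1(T)\},\,T_2\setminus\{n\})\,\}\cup\{(T_1+\{n\},\,T_2\setminus\{n\})\}.$$ Here $S$ ranges over all tableaux with entries $1,\dots,n$; every $S>T$ has at most two columns. In particular, every $S\in\mathcal D(T)$ has shape $\mathrm{sh}(S)=(\lambda_1(T)+1,\lambda_2(T)-1)$. -/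

import Mathlib

/-!  Fillings are written by columns, from left to right; every column is a list of natural
numbers, read from top to bottom.  All operations below are total functions on such lists of
columns; the relations and the theorem only concern those fillings that are tableaux. -/

namespace YoungTab

/-- A Young tableau, given as the list of its columns: distinct positive integers, columns
nonempty, of weakly decreasing length, strictly increasing from top to bottom, and rows strictly
increasing from left to right.  The empty tableau `[]` is allowed. -/
structure IsTableau (T : List (List ℕ)) : Prop where
  col_ne_nil : ∀ C ∈ T, C ≠ []
  col_increasing : ∀ C ∈ T, C.Pairwise (· < ·)
  rows : T.IsChain fun C D =>
    D.length ≤ C.length ∧ ∀ (i : ℕ) (hC : i < C.length) (hD : i < D.length), C[i] < D[i]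
  nodup : T.flatten.Nodup
  pos : ∀ a ∈ T.flatten, 0 < a

/-- A standard tableau with `n` boxes: the entries are `1, …, n`. -/
def IsStandard (n : ℕ) (T : List (List ℕ)) : Prop :=
  IsTableau T ∧ T.flatten.Perm (List.range' 1 n)

/-- The first column (empty if there is none). -/
def col₁ (T : List (List ℕ)) : List ℕ := T.headD []

/-- The second column (empty if there is none). -/
def col₂ (T : List (List ℕ)) : List ℕ := T.tail.headD []

/-- The bottom entry of the first column of a tableau, that is its largest entry. -/
def omega₁ (T : List (List ℕ)) : ℕ := (col₁ T).getLastD 0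

/-- The list of the column lengths. -/
def shape (T : List (List ℕ)) : List ℕ := T.map List.length

/-- Put a column in front of a tableau; an empty column is dropped. -/
def consCol (C : List ℕ) (T : List (List ℕ)) : List (List ℕ) :=
  if C = [] then T else C :: T

/-- The filling with the columns `C` and `D`, empty columns being dropped. -/
def ofCols (C D : List ℕ) : List (List ℕ) := consCol C (consCol D [])

/-- The column `C + {j}`: `j` is added at its place in the increasing column `C`. -/
def colAdd (C : List ℕ) (j : ℕ) : List ℕ := C.orderedInsert (· ≤ ·) j

/-! ### Insertion, the Robinson–Schensted procedure, deletion of a corner -/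

/-- Insertion `j → C` into an increasing column: `j` replaces the smallest entry greater than `j`,
which is returned as the second component; if there is none, `j` is put at the bottom. -/
def colInsert (j : ℕ) : List ℕ → List ℕ × Option ℕ
  | [] => ([j], none)
  | a :: C => if j < a then (j :: C, some a) else (a :: (colInsert j C).1, (colInsert j C).2)

/-- Insertion `j ⇒ T` into a tableau: the entry replaced in a column is inserted into the
next column. -/
def tabInsert (j : ℕ) : List (List ℕ) → List (List ℕ)
  | [] => [[j]]
  | C :: T =>
    match colInsert j C with
    | (C', none) => C' :: T
    | (C', some k) => C' :: tabInsert k T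

/-- The tableau `T(w) = a₁ ⇒ (a₂ ⇒ (⋯ ⇒ (aₙ ⇒ ∅)))` of the word `w = [a₁, …, aₙ]`. -/
def rsTableau (w : List ℕ) : List (List ℕ) := w.foldr tabInsert []

/-- Pushing `j` into an increasing column from the right: `j` replaces the greatest entry smaller
than `j`, which is returned as the second component. -/
def colPush (C : List ℕ) (j : ℕ) : List ℕ × ℕ :=
  match (C.filter (· < j)).getLast? with
  | none => (C, j)
  | some a => (C.map fun x => if x = a then j else x, a)

/-- Deletion of the corner with entry `x`: `x` is deleted from its column and pushed left through
the previous columns.  The second component is the entry pushed out of the tableau. -/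
def deleteAux (x : ℕ) : List (List ℕ) → List (List ℕ) × ℕ
  | [] => ([], x)
  | C :: T =>
    if x ∈ C then (consCol (C.erase x) T, x)
    else ((colPush C (deleteAux x T).2).1 :: (deleteAux x T).1, (colPush C (deleteAux x T).2).2)

/-- The tableau `T ⇐ x`, for a corner entry `x` of `T`. -/
def deleteCorner (T : List (List ℕ)) (x : ℕ) : List (List ℕ) := (deleteAux x T).1

/-! ### Jeu de taquin -/

/-- Sliding of a hole.  The hole is in the column whose entries above and below the hole are `above`
and `below`; `rest` is the list of the columns further right.  The smaller of the right and the
lower neighbour moves into the hole, until the hole has arrived at a corner. -/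
def slide (above below : List ℕ) (rest : List (List ℕ)) : List (List ℕ) :=
  match rest, below with
  | [], below => consCol (above ++ below) []
  | D :: R, [] =>
    match D[above.length]? with
    | none => consCol above (D :: R)
    | some x => (above ++ [x]) :: slide (D.take above.length) (D.drop (above.length + 1)) R
  | D :: R, y :: below' =>
    match D[above.length]? with
    | none => (above ++ y :: below') :: D :: R
    | some x =>
      if y < x then slide (above ++ [y]) below' (D :: R)
      else (above ++ x :: y :: below') ::
        slide (D.take above.length) (D.drop (above.length + 1)) R
termination_by (rest.length, below.length)

/-- Removal of the entry `x` by jeu de taquin (nothing happens if `x` is not an entry). -/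
def jdtRemove (T : List (List ℕ)) (x : ℕ) : List (List ℕ) :=
  match T with
  | [] => []
  | C :: R =>
    if x ∈ C then slide (C.take (C.idxOf x)) (C.drop (C.idxOf x + 1)) R
    else C :: jdtRemove R x

/-- The projection of `T` to the letters in `[a, b]`: the entries less than `a` (the smallest one
first) and the entries greater than `b` (the greatest one first) are removed by jeu de taquin. -/
def proj (a b : ℕ) (T : List (List ℕ)) : List (List ℕ) :=
  let small := (T.flatten.filter (· < a)).insertionSort (· ≤ ·)
  let large := (T.flatten.filter (b < ·)).insertionSort (· ≥ ·)
  (small ++ large).foldl jdtRemove T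

/-! ### The orders -/

/-- The right weak order on the words with the same distinct letters: the inversions of `w` are
inversions of `y`. -/
def WeakLE (w y : List ℕ) : Prop :=
  w.Nodup ∧ w.Perm y ∧
    ∀ a ∈ w, ∀ b ∈ w, a < b → w.idxOf b < w.idxOf a → y.idxOf b < y.idxOf a

/-- The order on tableaux induced by the weak order on words, `T ≤ S`: there is a sequence
`T = P₁, …, P_k = S` of tableaux such that for all `j` some word of the cell of `P_j` is less than
or equal to some word of the cell of `P_{j+1}`. -/
def DufloLE (T S : List (List ℕ)) : Prop :=
  IsTableau T ∧ IsTableau S ∧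
    Relation.ReflTransGen
      (fun P Q => IsTableau P ∧ IsTableau Q ∧
        ∃ w y : List ℕ, rsTableau w = P ∧ rsTableau y = Q ∧ WeakLE w y) T S

/-- The dominance order `mu ≤ la` on partitions (of the same number). -/
def DominanceLE (mu la : List ℕ) : Prop :=
  ∀ i, 1 ≤ i → i ≤ min la.length mu.length → (mu.take i).sum ≤ (la.take i).sum

/-- The chain order on tableaux with the same entries, `T ≤ S`: for all entries `a < b` the shape
of the projection of `T` to the letters in `[a, b]` is dominated by that of `S`. -/
def ChainLE (T S : List (List ℕ)) : Prop :=
  IsTableau T ∧ IsTableau S ∧ T.flatten.Perm S.flatten ∧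
    ∀ a ∈ T.flatten, ∀ b ∈ T.flatten, a < b →
      DominanceLE (shape (proj a b T)) (shape (proj a b S))

/-- The strict relation of an order. -/
def Lt (le : List (List ℕ) → List (List ℕ) → Prop) (T S : List (List ℕ)) : Prop :=
  le T S ∧ T ≠ S

/-- The cover of `T`: the elements greater than `T` with nothing strictly in between. -/
def cover (le : List (List ℕ) → List (List ℕ) → Prop) (T : List (List ℕ)) :
    Set (List (List ℕ)) :=
  {S | Lt le T S ∧ ¬ ∃ P, Lt le T P ∧ Lt le P S}

end YoungTab

namespace YoungTab

/-! ### Counting functions and two-column tableaux -/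

/-! Read the entries of a two-column tableau in increasing order as a bracket word: an entry of the
first column `A` opens, an entry of the second column `B` closes. Being a tableau is then the ballot
condition in `Valid`. Both orders become one relation, `BalLE`: every interval that is balanced in
the larger tableau is balanced in the smaller one. What remains is a question about the last
bracket.

The link is the length of the first column of the projection to `[a, b)`. It is the maximum over `a
≤ c ≤ b` of the number of closing entries in `[a, c)` plus the number of opening entries in `[c,
b)`; `MaxLE` bounds this maximum. Jeu de taquin gives this formula (`Valid.proj`), which handles the
chain order. The same maximum is the length of a longest decreasing subsequence with letters in `[a,
b)` in any word of the tableau (`RSData`, a two-column form of Greene's theorem). Going up in the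
weak order keeps decreasing subsequences and creates no increasing triple, so one never leaves the
two-column tableaux and these lengths can only grow. An interval is balanced when the length is half
the number of entries, the least possible value. Hence each order implies `BalLE`.

Conversely, if `BalLE` holds and `B ≠ B'`, the largest `j` in `B \ B'` can be moved to the first
column without passing the larger tableau (`BalLE.exists_move`). Such a move is a step of the weak
order: in a suitable word `j` jumps left over smaller letters (`dufloLE_move`). Iteration leads from
`BalLE` to the induced weak order, from there to the comparison of all `MaxLE` bounds, hence to the
chain order. It also shows that covers are exactly the comparable pairs whose second columns differ
by one box (`IsBalOrder.mem_cover_iff`).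

If `n` opens, no balanced interval ends at `n`, so `n` can be added or removed freely. If `n` closes
in `T`, then in `S > T` it either opens, and is erased, or still closes. In the latter case `S` has
the same greatest first-column entry `m` as `T` (`MaxRight.of_balLE`), and deletion of the corner
`n` removes `m` and turns `n` into an opening bracket in both. All letters strictly between `m` and
`n` close, so a balanced interval of the deletion reaching beyond `m` becomes one of the original
after prolonging it by one letter (`MaxRight.balLE_delete`). The way back is monotonicity of
insertion (`DufloLE.tabInsert`). -/

/-- The number of elements of `A` below `c`. -/
def cnt (A : Finset ℕ) (c : ℕ) : ℕ := (A.filter (· < c)).card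

theorem cnt_insert {A : Finset ℕ} {x : ℕ} (hx : x ∉ A) (c : ℕ) :
    cnt (insert x A) c = cnt A c + if x < c then 1 else 0 := by
  unfold cnt
  rw [Finset.filter_insert]
  split_ifs with h
  · rw [Finset.card_insert_of_notMem (by simp [hx])]
  · rfl

theorem cnt_erase {A : Finset ℕ} {x : ℕ} (hx : x ∈ A) (c : ℕ) :
    cnt (A.erase x) c + (if x < c then 1 else 0) = cnt A c := by
  rw [← cnt_insert (Finset.notMem_erase x A), Finset.insert_erase hx]

theorem cnt_mono (A : Finset ℕ) {c d : ℕ} (h : c ≤ d) : cnt A c ≤ cnt A d :=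
  Finset.card_le_card fun t ht => by
    simp only [Finset.mem_filter] at ht ⊢
    exact ⟨ht.1, by omega⟩

theorem cnt_le_card (A : Finset ℕ) (c : ℕ) : cnt A c ≤ A.card :=
  Finset.card_le_card (Finset.filter_subset _ _)

theorem cnt_eq_card {A : Finset ℕ} {c : ℕ} (h : ∀ t ∈ A, t < c) : cnt A c = A.card := by
  unfold cnt
  rw [Finset.filter_true_of_mem h]

theorem cnt_eq_zero {A : Finset ℕ} {c : ℕ} (h : ∀ t ∈ A, c ≤ t) : cnt A c = 0 := by
  unfold cnt
  rw [Finset.filter_false_of_mem fun t ht => by have := h t ht; omega, Finset.card_empty]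

@[simp] theorem cnt_zero (A : Finset ℕ) : cnt A 0 = 0 := cnt_eq_zero fun _ _ => Nat.zero_le _

@[simp] theorem cnt_empty (c : ℕ) : cnt ∅ c = 0 := by simp [cnt]

theorem cnt_congr {A B : Finset ℕ} {c : ℕ} (h : ∀ t < c, t ∈ A ↔ t ∈ B) : cnt A c = cnt B c := by
  unfold cnt
  congr 1
  ext t
  simp only [Finset.mem_filter]
  constructor
  · rintro ⟨h1, h2⟩; exact ⟨(h t h2).1 h1, h2⟩
  · rintro ⟨h1, h2⟩; exact ⟨(h t h2).2 h1, h2⟩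

theorem cnt_eq_of_gap {A : Finset ℕ} {c d : ℕ} (hcd : c ≤ d) (h : ∀ t ∈ A, c ≤ t → d ≤ t) :
    cnt A c = cnt A d := by
  unfold cnt
  congr 1
  ext t
  simp only [Finset.mem_filter]
  constructor
  · rintro ⟨h1, h2⟩; exact ⟨h1, by omega⟩
  · rintro ⟨h1, h2⟩
    refine ⟨h1, ?_⟩
    by_contra h3
    have := h t h1 (by omega)
    omega

theorem cnt_succ (A : Finset ℕ) (c : ℕ) : cnt A (c + 1) = cnt A c + if c ∈ A then 1 else 0 := by
  split_ifs with h
  · have h1 := cnt_erase h c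
    have h2 := cnt_erase h (c + 1)
    have h3 : cnt (A.erase c) c = cnt (A.erase c) (c + 1) :=
      cnt_eq_of_gap (Nat.le_succ c) fun t ht h4 => by
        have := Finset.ne_of_mem_erase ht
        omega
    simp at h1 h2
    omega
  · exact (cnt_eq_of_gap (Nat.le_succ c) fun t ht h4 => by
      have : t ≠ c := fun h5 => h (h5 ▸ ht)
      omega).symm

theorem cnt_union {A B : Finset ℕ} (h : Disjoint A B) (c : ℕ) :
    cnt (A ∪ B) c = cnt A c + cnt B c := by
  unfold cnt
  rw [Finset.filter_union, Finset.card_union_of_disjoint (Finset.disjoint_filter_filter h)]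

theorem cnt_filter_Ico (A : Finset ℕ) {a b : ℕ} (h : a ≤ b) :
    (A.filter fun t => a ≤ t ∧ t < b).card + cnt A a = cnt A b := by
  unfold cnt
  rw [← Finset.card_union_of_disjoint]
  · congr 1
    ext t
    simp only [Finset.mem_filter, Finset.mem_union]
    constructor
    · rintro (h1 | h1)
      · exact ⟨h1.1, h1.2.2⟩
      · exact ⟨h1.1, by omega⟩
    · intro h1
      by_cases h2 : a ≤ t
      · exact Or.inl ⟨h1.1, h2, h1.2⟩
      · exact Or.inr ⟨h1.1, by omega⟩
  · rw [Finset.disjoint_left]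
    intro t h1 h2
    simp only [Finset.mem_filter] at h1 h2
    omega

/-! ### Increasing lists as finite sets; the row condition by counting -/

theorem sort_eq_of_pairwise {l : List ℕ} {A : Finset ℕ} (hl : l.Pairwise (· < ·))
    (h : ∀ x, x ∈ l ↔ x ∈ A) : A.sort = l := by
  have hA : A = l.toFinset := by ext x; simp [h]
  subst hA
  rw [List.toFinset_sort (· ≤ ·) (hl.imp fun h => Nat.ne_of_lt h)]
  exact hl.imp fun h => Nat.le_of_lt h

theorem pairwise_sort (A : Finset ℕ) : A.sort.Pairwise (· < ·) := A.sortedLT_sort.pairwise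

theorem sort_toFinset_of_pairwise {l : List ℕ} (hl : l.Pairwise (· < ·)) : l.toFinset.sort = l :=
  sort_eq_of_pairwise hl fun x => by simp

theorem cnt_toFinset {l : List ℕ} (hl : l.Pairwise (· < ·)) (c : ℕ) :
    cnt l.toFinset c = l.countP (· < c) := by
  have hn : l.Nodup := hl.imp fun h => Nat.ne_of_lt h
  unfold cnt
  rw [List.countP_eq_length_filter, ← List.toFinset_card_of_nodup (hn.filter _)]
  congr 1
  ext t
  simp

/-- Each entry of `D` has a smaller left neighbour in `C`. Together with `rows_of_countP_le` this
turns the row condition into an inequality of counting functions. -/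
theorem countP_le_of_rows : ∀ {C D : List ℕ}, D.length ≤ C.length →
    (∀ (i : ℕ) (hC : i < C.length) (hD : i < D.length), C[i] < D[i]) → ∀ c,
    D.countP (· < c) ≤ C.countP (· < c)
  | _, [], _, _, c => by simp
  | [], _ :: _, h, _, c => by simp at h
  | x :: C, y :: D, h, h', c => by
    have h1 := countP_le_of_rows (C := C) (D := D) (by simpa using h)
      (fun i hC hD => h' (i + 1) (Nat.succ_lt_succ hC) (Nat.succ_lt_succ hD)) c
    have h2 := h' 0 (by simp) (by simp)
    simp only [List.getElem_cons_zero] at h2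
    simp only [List.countP_cons, decide_eq_true_eq]
    split_ifs <;> omega

/-- Counting below `y + 1` forces `x < y` for the top entries. The inequality survives removal of
the top row: beyond `y` both sides lose one, and up to `y` nothing of `D` is counted. -/
theorem rows_of_countP_le : ∀ {C D : List ℕ}, C.Pairwise (· < ·) → D.Pairwise (· < ·) →
    (∀ x ∈ C, x ∉ D) → (∀ c, D.countP (· < c) ≤ C.countP (· < c)) →
    D.length ≤ C.length ∧
      ∀ (i : ℕ) (hC : i < C.length) (hD : i < D.length), C[i] < D[i]
  | _, [], _, _, _, _ => by simp
  | [], y :: D, _, _, _, h => by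
    have := h (y + 1)
    simp at this
  | x :: C, y :: D, hC, hD, hd, h => by
    rw [List.pairwise_cons] at hC hD
    have hxy : x < y := by
      by_contra hxy
      have hne : x ≠ y := fun h => hd x (by simp) (by simp [h])
      have h1 := h (y + 1)
      have h2 : C.countP (· < y + 1) = 0 := by
        rw [List.countP_eq_zero]
        intro t ht
        have := hC.1 t ht
        simp; omega
      simp only [List.countP_cons, decide_eq_true_eq, h2] at h1
      rw [if_pos (by omega), if_neg (by omega)] at h1
      omega
    have ih := rows_of_countP_le hC.2 hD.2 (fun t ht ht' => hd t (by simp [ht]) (by simp [ht']))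
      (fun c => by
        have h1 := h c
        simp only [List.countP_cons, decide_eq_true_eq] at h1
        by_cases hc : y < c
        · rw [if_pos hc, if_pos (by omega)] at h1
          omega
        · have h2 : D.countP (· < c) = 0 := by
            rw [List.countP_eq_zero]
            intro t ht
            have := hD.1 t ht
            simp; omega
          omega)
    refine ⟨by simpa using ih.1, ?_⟩
    rintro (_ | i) h1 h2
    · exact hxy
    · simpa using ih.2 i (by simpa using h1) (by simpa using h2)

/-! ### Two-column tableaux as pairs of finite sets -/

/-- The filling with the columns `A` and `B`, given as sets. -/
def cols (A B : Finset ℕ) : List (List ℕ) := ofCols A.sort B.sort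

/-- The conditions on the sets of entries of the columns of a two-column tableau. -/
structure Valid (A B : Finset ℕ) : Prop where
  disj : Disjoint A B
  pos : ∀ t ∈ A ∪ B, 0 < t
  ballot : ∀ c, cnt B c ≤ cnt A c

theorem Valid.empty : Valid ∅ ∅ := ⟨by simp, by simp, by simp⟩

theorem Valid.notMem_right {A B : Finset ℕ} (h : Valid A B) {x : ℕ} (hx : x ∈ A) : x ∉ B :=
  Finset.disjoint_left.1 h.disj hx

/-- The ballot inequality at a point beyond all entries. -/
theorem Valid.card_le {A B : Finset ℕ} (h : Valid A B) : B.card ≤ A.card := by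
  have h1 : ∀ t ∈ A ∪ B, t < (A ∪ B).sup id + 1 := fun t ht =>
    Nat.lt_succ_of_le (Finset.le_sup (f := id) ht)
  have h2 := h.ballot ((A ∪ B).sup id + 1)
  rwa [cnt_eq_card fun t ht => h1 t (Finset.mem_union_left _ ht),
    cnt_eq_card fun t ht => h1 t (Finset.mem_union_right _ ht)] at h2

theorem Valid.right_eq_empty {A B : Finset ℕ} (h : Valid A B) (hA : A = ∅) : B = ∅ := by
  have := h.card_le
  subst hA
  simpa using this

theorem cols_empty : cols ∅ ∅ = [] := by simp [cols, ofCols, consCol]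

theorem sort_ne_nil {A : Finset ℕ} (hA : A ≠ ∅) : A.sort ≠ [] :=
  fun h => hA (by rw [← A.sort_toFinset (· ≤ ·), h]; rfl)

theorem cols_empty_right {A : Finset ℕ} (hA : A ≠ ∅) : cols A ∅ = [A.sort] := by
  simp [cols, ofCols, consCol, sort_ne_nil hA]

theorem cols_of_ne {A B : Finset ℕ} (hA : A ≠ ∅) (hB : B ≠ ∅) : cols A B = [A.sort, B.sort] := by
  simp [cols, ofCols, consCol, sort_ne_nil hA, sort_ne_nil hB]

theorem Valid.cases {A B : Finset ℕ} (h : Valid A B) :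
    (A = ∅ ∧ B = ∅ ∧ cols A B = []) ∨ (A ≠ ∅ ∧ B = ∅ ∧ cols A B = [A.sort]) ∨
      (A ≠ ∅ ∧ B ≠ ∅ ∧ cols A B = [A.sort, B.sort]) := by
  by_cases hA : A = ∅
  · have hB := h.right_eq_empty hA
    exact Or.inl ⟨hA, hB, by rw [hA, hB, cols_empty]⟩
  · by_cases hB : B = ∅
    · exact Or.inr (Or.inl ⟨hA, hB, by rw [hB, cols_empty_right hA]⟩)
    · exact Or.inr (Or.inr ⟨hA, hB, cols_of_ne hA hB⟩)

theorem cols_length_le (A B : Finset ℕ) : (cols A B).length ≤ 2 := by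
  unfold cols ofCols consCol
  split_ifs <;> simp

theorem Valid.col₁_eq {A B : Finset ℕ} (h : Valid A B) : col₁ (cols A B) = A.sort := by
  rcases h.cases with ⟨rfl, rfl, h⟩ | ⟨_, _, h⟩ | ⟨_, _, h⟩ <;> simp [h, col₁]

theorem Valid.col₂_eq {A B : Finset ℕ} (h : Valid A B) : col₂ (cols A B) = B.sort := by
  rcases h.cases with ⟨rfl, rfl, h⟩ | ⟨_, rfl, h⟩ | ⟨_, _, h⟩ <;> simp [h, col₂]

theorem Valid.cols_inj {A B A' B' : Finset ℕ} (h : Valid A B) (h' : Valid A' B')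
    (he : cols A B = cols A' B') : A = A' ∧ B = B' := by
  have h1 := h.col₁_eq
  have h2 := h.col₂_eq
  rw [he, h'.col₁_eq] at h1
  rw [he, h'.col₂_eq] at h2
  constructor
  · rw [← A.sort_toFinset (· ≤ ·), ← h1, Finset.sort_toFinset]
  · rw [← B.sort_toFinset (· ≤ ·), ← h2, Finset.sort_toFinset]

theorem flatten_cols (A B : Finset ℕ) : (cols A B).flatten = A.sort ++ B.sort := by
  unfold cols ofCols consCol
  split_ifs with h1 h2 h2 <;> simp [h1, h2]

theorem mem_flatten_cols {A B : Finset ℕ} {x : ℕ} : x ∈ (cols A B).flatten ↔ x ∈ A ∪ B := by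
  simp [flatten_cols]

theorem Valid.nodup_flatten {A B : Finset ℕ} (h : Valid A B) : (cols A B).flatten.Nodup := by
  rw [flatten_cols, List.nodup_append']
  refine ⟨A.sort_nodup _, B.sort_nodup _, fun x hx hx' => ?_⟩
  rw [Finset.mem_sort] at hx hx'
  exact h.notMem_right hx hx'

theorem cnt_eq_countP (A : Finset ℕ) (c : ℕ) : cnt A c = A.sort.countP (· < c) := by
  conv_lhs => rw [← A.sort_toFinset (· ≤ ·)]
  exact cnt_toFinset (pairwise_sort A) c

theorem Valid.isTableau {A B : Finset ℕ} (h : Valid A B) : IsTableau (cols A B) := by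
  refine ⟨?_, ?_, ?_, h.nodup_flatten, fun a ha => h.pos a (mem_flatten_cols.1 ha)⟩
  · rcases h.cases with ⟨hA, hB, h⟩ | ⟨hA, hB, h⟩ | ⟨hA, hB, h⟩ <;>
      rw [h] <;> simp [sort_ne_nil, hA, hB]
  · rcases h.cases with ⟨hA, hB, h⟩ | ⟨hA, hB, h⟩ | ⟨hA, hB, h⟩ <;>
      simp [h, pairwise_sort]
  · have h1 := rows_of_countP_le (pairwise_sort A) (pairwise_sort B)
      (fun x hx hx' => h.notMem_right ((Finset.mem_sort _).1 hx) ((Finset.mem_sort _).1 hx'))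
      (fun c => by rw [← cnt_eq_countP, ← cnt_eq_countP]; exact h.ballot c)
    rcases h.cases with ⟨hA, hB, h⟩ | ⟨hA, hB, h⟩ | ⟨hA, hB, h⟩
    · simp [h]
    · simp [h]
    · rw [h, List.isChain_pair]
      exact h1

theorem IsTableau.exists_cols {T : List (List ℕ)} (h : IsTableau T) (h2 : T.length ≤ 2) :
    ∃ A B, Valid A B ∧ T = cols A B := by
  match T, h2 with
  | [], _ => exact ⟨∅, ∅, Valid.empty, cols_empty.symm⟩
  | [C], _ =>
    have hC := h.col_increasing C (by simp)
    have hne : C ≠ [] := h.col_ne_nil C (by simp)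
    refine ⟨C.toFinset, ∅, ⟨by simp, fun t ht => h.pos t (by simpa using ht), by simp⟩, ?_⟩
    rw [cols_empty_right (by simpa using hne), sort_toFinset_of_pairwise hC]
  | [C, D], _ =>
    have hC := h.col_increasing C (by simp)
    have hD := h.col_increasing D (by simp)
    have hneC : C ≠ [] := h.col_ne_nil C (by simp)
    have hneD : D ≠ [] := h.col_ne_nil D (by simp)
    have hr := List.isChain_pair.1 h.rows
    have hd := h.nodup
    refine ⟨C.toFinset, D.toFinset, ⟨?_, fun t ht => h.pos t (by simpa using ht), fun c => ?_⟩, ?_⟩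
    · simp only [List.flatten_cons, List.flatten_nil, List.append_nil, List.nodup_append'] at hd
      rw [List.disjoint_toFinset_iff_disjoint]
      exact hd.2.2
    · rw [cnt_toFinset hC, cnt_toFinset hD]
      exact countP_le_of_rows hr.1 hr.2 c
    · rw [cols_of_ne (by simpa using hneC) (by simpa using hneD), sort_toFinset_of_pairwise hC,
        sort_toFinset_of_pairwise hD]
  | _ :: _ :: _ :: _, h2 => simp at h2

/-! ### Column insertion into a two-column tableau -/

theorem colInsert_of_forall_lt {x : ℕ} : ∀ {C : List ℕ}, (∀ a ∈ C, a < x) →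
    colInsert x C = (C ++ [x], none)
  | [], _ => rfl
  | a :: C, h => by
    have h1 : ¬ x < a := by have := h a (by simp); omega
    rw [colInsert, if_neg h1, colInsert_of_forall_lt fun b hb => h b (by simp [hb])]
    rfl

theorem colInsert_of_split {x z : ℕ} : ∀ {C D : List ℕ}, (∀ a ∈ C, a < x) → x < z →
    colInsert x (C ++ z :: D) = (C ++ x :: D, some z)
  | [], D, _, h => by simp [colInsert, h]
  | a :: C, D, h, h' => by
    have h1 : ¬ x < a := by have := h a (by simp); omega
    rw [List.cons_append, colInsert, if_neg h1,
      colInsert_of_split (fun b hb => h b (by simp [hb])) h']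
    rfl

theorem sort_insert_of_forall_lt {A : Finset ℕ} {x : ℕ} (h : ∀ a ∈ A, a < x) :
    (insert x A).sort = A.sort ++ [x] := by
  refine sort_eq_of_pairwise ?_ fun y => by simp [or_comm]
  rw [List.pairwise_append]
  exact ⟨pairwise_sort A, by simp, by simpa using h⟩

theorem exists_sort_split {A : Finset ℕ} {z : ℕ} (hz : z ∈ A) :
    ∃ C D, A.sort = C ++ z :: D := List.append_of_mem ((Finset.mem_sort _).2 hz)

theorem colInsert_sort {A : Finset ℕ} {x z : ℕ} (hxA : x ∉ A) (hz : z ∈ A) (hxz : x < z)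
    (hgap : ∀ a ∈ A, a < z → a < x) :
    colInsert x A.sort = ((insert x (A.erase z)).sort, some z) := by
  obtain ⟨C, D, hCD⟩ := exists_sort_split hz
  have hs := pairwise_sort A
  have hmem : ∀ t, t ∈ A ↔ t ∈ C ∨ t = z ∨ t ∈ D := fun t => by
    rw [← Finset.mem_sort (· ≤ ·), hCD]; simp
  rw [hCD, List.pairwise_append, List.pairwise_cons] at hs
  obtain ⟨hC, ⟨hzD, hD⟩, hC2⟩ := hs
  have hCx : ∀ a ∈ C, a < x := fun a ha =>
    hgap a ((hmem a).2 (Or.inl ha)) (hC2 a ha z (by simp))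
  rw [hCD, colInsert_of_split hCx hxz]
  congr 1
  symm
  refine sort_eq_of_pairwise ?_ fun y => ?_
  · rw [List.pairwise_append, List.pairwise_cons]
    refine ⟨hC, ⟨fun t ht => hxz.trans (hzD t ht), hD⟩, fun a ha b hb => ?_⟩
    rcases List.mem_cons.1 hb with rfl | hb
    · exact hCx a ha
    · exact hC2 a ha b (by simp [hb])
  · simp only [List.mem_append, List.mem_cons, Finset.mem_insert, Finset.mem_erase, hmem]
    constructor
    · rintro (h | rfl | h)
      · have := hC2 y h z (by simp)
        exact Or.inr ⟨by omega, Or.inl h⟩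
      · exact Or.inl rfl
      · have := hzD y h
        exact Or.inr ⟨by omega, Or.inr (Or.inr h)⟩
    · rintro (rfl | ⟨h1, h2 | h2 | h2⟩)
      · simp
      · exact Or.inl h2
      · exact absurd h2 h1
      · exact Or.inr (Or.inr h2)

/-- `cols` drops empty columns, so for `A = ∅` a nonempty `B` would itself be the column receiving
`x`; `hAB` rules this out. -/
theorem tabInsert_cols_of_forall_lt {A B : Finset ℕ} {x : ℕ} (hAB : A = ∅ → B = ∅)
    (h : ∀ a ∈ A, a < x) : tabInsert x (cols A B) = cols (insert x A) B := by
  by_cases hA : A = ∅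
  · have hB := hAB hA
    subst hA hB
    rw [cols_empty, cols_empty_right (by simp), sort_insert_of_forall_lt h]
    simp [tabInsert]
  · have h1 : colInsert x A.sort = (A.sort ++ [x], none) :=
      colInsert_of_forall_lt fun a ha => h a ((Finset.mem_sort _).1 ha)
    by_cases hB : B = ∅
    · subst hB
      rw [cols_empty_right hA, cols_empty_right (by simp), sort_insert_of_forall_lt h]
      simp [tabInsert, h1]
    · rw [cols_of_ne hA hB, cols_of_ne (by simp) hB, sort_insert_of_forall_lt h]
      simp [tabInsert, h1]

/-- The bumped entry `z` exceeds all of `B` and stops at its bottom. If some entry of `B` is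
greater, a third column arises, see `three_le_length_tabInsert`. -/
theorem tabInsert_cols_of_bump {A B : Finset ℕ} {x z : ℕ} (hxA : x ∉ A) (hz : z ∈ A) (hxz : x < z)
    (hgap : ∀ a ∈ A, a < z → a < x) (hB : ∀ b ∈ B, b < z) :
    tabInsert x (cols A B) = cols (insert x (A.erase z)) (insert z B) := by
  have hA : A ≠ ∅ := Finset.ne_empty_of_mem hz
  have h1 := colInsert_sort hxA hz hxz hgap
  rw [cols_of_ne (A := insert x _) (B := insert z B) (by simp) (by simp),
    sort_insert_of_forall_lt hB]
  by_cases hB0 : B = ∅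
  · subst hB0
    rw [cols_empty_right hA]
    simp [tabInsert, h1]
  · rw [cols_of_ne hA hB0]
    have h2 : colInsert z B.sort = (B.sort ++ [z], none) :=
      colInsert_of_forall_lt fun a ha => hB a ((Finset.mem_sort _).1 ha)
    simp [tabInsert, h1, h2]

theorem colInsert_snd_eq_none {x : ℕ} : ∀ {C : List ℕ}, (colInsert x C).2 = none → ∀ a ∈ C, a ≤ x
  | [], _ => by simp
  | a :: C, h => by
    rw [colInsert] at h
    split_ifs at h with h1
    intro b hb
    rcases List.mem_cons.1 hb with rfl | hb
    · omega
    · exact colInsert_snd_eq_none h b hb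

theorem length_le_length_tabInsert (x : ℕ) (T : List (List ℕ)) :
    T.length ≤ (tabInsert x T).length := by
  induction T generalizing x with
  | nil => simp
  | cons C T ih =>
    rw [tabInsert]
    rcases colInsert x C with ⟨C', _ | k⟩
    · simp
    · simpa using ih k

theorem three_le_length_tabInsert {A B : Finset ℕ} {x z b : ℕ} (hxA : x ∉ A) (hz : z ∈ A)
    (hxz : x < z) (hgap : ∀ a ∈ A, a < z → a < x) (hb : b ∈ B) (hzb : z < b) :
    3 ≤ (tabInsert x (cols A B)).length := by
  rw [cols_of_ne (Finset.ne_empty_of_mem hz) (Finset.ne_empty_of_mem hb), tabInsert,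
    colInsert_sort hxA hz hxz hgap]
  have h1 : (colInsert z B.sort).2 ≠ none := fun h => by
    have := colInsert_snd_eq_none h b ((Finset.mem_sort _).2 hb)
    omega
  simp only [List.length_cons, tabInsert]
  rcases h : colInsert z B.sort with ⟨C', _ | k⟩
  · simp [h] at h1
  · simp [h]

/-- The alternatives for the insertion of `x` into the first column `A`. -/
theorem insert_cases {A : Finset ℕ} {x : ℕ} (hxA : x ∉ A) :
    (∀ a ∈ A, a < x) ∨ ∃ z ∈ A, x < z ∧ ∀ a ∈ A, a < z → a < x := by
  by_cases h : ∀ a ∈ A, a < x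
  · exact Or.inl h
  · right
    push Not at h
    obtain ⟨a, ha, hax⟩ := h
    have hne : (A.filter (x < ·)).Nonempty :=
      ⟨a, by
        have : a ≠ x := fun h => hxA (h ▸ ha)
        simp only [Finset.mem_filter]; exact ⟨ha, by omega⟩⟩
    have hm := Finset.min'_mem _ hne
    rw [Finset.mem_filter] at hm
    refine ⟨_, hm.1, hm.2, fun b hb hlt => ?_⟩
    by_contra hbx
    have : b ≠ x := fun h => hxA (h ▸ hb)
    have := Finset.min'_le (A.filter (x < ·)) b (by simp only [Finset.mem_filter]; exact ⟨hb, by omega⟩)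
    omega

/-! ### Words: decreasing subsequences and ascents -/

/-- The set of letters `X` forms a decreasing subsequence of the word `w`. -/
def DecIn (w : List ℕ) (X : Finset ℕ) : Prop :=
  (∀ x ∈ X, x ∈ w) ∧ ∀ x ∈ X, ∀ y ∈ X, x < y → w.idxOf y < w.idxOf x

/-- The word `w` contains an increasing subsequence of length two that starts with `a`. -/
def AscentAt (w : List ℕ) (a : ℕ) : Prop :=
  a ∈ w ∧ ∃ b ∈ w, a < b ∧ w.idxOf a < w.idxOf b

/-- The word `w` contains an increasing subsequence of length three. -/
def HasTriple (w : List ℕ) : Prop :=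
  ∃ a ∈ w, ∃ b ∈ w, ∃ c ∈ w, a < b ∧ b < c ∧ w.idxOf a < w.idxOf b ∧ w.idxOf b < w.idxOf c

theorem idxOf_cons_lt {x a b : ℕ} {w : List ℕ} (ha : a ≠ x) (hb : b ≠ x) :
    (x :: w).idxOf a < (x :: w).idxOf b ↔ w.idxOf a < w.idxOf b := by
  rw [List.idxOf_cons_ne _ (Ne.symm ha), List.idxOf_cons_ne _ (Ne.symm hb)]
  omega

theorem idxOf_cons_self_lt {x b : ℕ} {w : List ℕ} (hb : b ≠ x) :
    (x :: w).idxOf x < (x :: w).idxOf b := by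
  rw [List.idxOf_cons_self, List.idxOf_cons_ne _ (Ne.symm hb)]
  omega

theorem not_idxOf_cons_lt_self {x b : ℕ} {w : List ℕ} :
    ¬ (x :: w).idxOf b < (x :: w).idxOf x := by
  rw [List.idxOf_cons_self]
  omega

theorem DecIn.cons {w : List ℕ} {X : Finset ℕ} {x : ℕ} (hx : x ∉ w) (h : DecIn w X) :
    DecIn (x :: w) X := by
  have hne : ∀ y ∈ X, y ≠ x := fun y hy he => hx (he ▸ h.1 y hy)
  exact ⟨fun y hy => by simp [h.1 y hy], fun y hy z hz hyz =>
    (idxOf_cons_lt (hne z hz) (hne y hy)).2 (h.2 y hy z hz hyz)⟩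

theorem DecIn.cons_insert {w : List ℕ} {X : Finset ℕ} {x : ℕ} (hx : x ∉ w) (h : DecIn w X)
    (hlt : ∀ y ∈ X, y < x) : DecIn (x :: w) (insert x X) := by
  have hne : ∀ y ∈ X, y ≠ x := fun y hy he => hx (he ▸ h.1 y hy)
  refine ⟨fun y hy => ?_, fun y hy z hz hyz => ?_⟩
  · rcases Finset.mem_insert.1 hy with rfl | hy
    · simp
    · simp [h.1 y hy]
  · rcases Finset.mem_insert.1 hy with rfl | hy' <;> rcases Finset.mem_insert.1 hz with rfl | hz'
    · omega
    · have := hlt z hz'; omega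
    · exact idxOf_cons_self_lt (hne y hy')
    · exact (idxOf_cons_lt (hne z hz') (hne y hy')).2 (h.2 y hy' z hz' hyz)

theorem DecIn.of_cons {w : List ℕ} {X : Finset ℕ} {x : ℕ} (h : DecIn (x :: w) X) (hx : x ∉ X) :
    DecIn w X := by
  have hne : ∀ y ∈ X, y ≠ x := fun y hy he => hx (he ▸ hy)
  exact ⟨fun y hy => by simpa [hne y hy] using h.1 y hy, fun y hy z hz hyz =>
    (idxOf_cons_lt (hne z hz) (hne y hy)).1 (h.2 y hy z hz hyz)⟩

theorem DecIn.mono {w : List ℕ} {X Y : Finset ℕ} (h : DecIn w X) (hY : Y ⊆ X) : DecIn w Y :=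
  ⟨fun x hx => h.1 x (hY hx), fun x hx y hy => h.2 x (hY hx) y (hY hy)⟩

theorem DecIn.lt_of_cons {w : List ℕ} {X : Finset ℕ} {x y : ℕ} (h : DecIn (x :: w) X) (hx : x ∈ X)
    (hy : y ∈ X) (hne : y ≠ x) : y < x := by
  by_contra hlt
  exact not_idxOf_cons_lt_self (h.2 x hx y hy (by omega))

theorem AscentAt.cons {w : List ℕ} {a x : ℕ} (hx : x ∉ w) (h : AscentAt w a) :
    AscentAt (x :: w) a := by
  obtain ⟨ha, b, hb, hab, hi⟩ := h
  exact ⟨by simp [ha], b, by simp [hb], hab,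
    (idxOf_cons_lt (by rintro rfl; exact hx ha) (by rintro rfl; exact hx hb)).2 hi⟩

theorem ascentAt_cons_self {w : List ℕ} {x b : ℕ} (hb : b ∈ w) (hxb : x < b) :
    AscentAt (x :: w) x :=
  ⟨by simp, b, by simp [hb], hxb, idxOf_cons_self_lt (by omega)⟩

theorem AscentAt.of_cons {w : List ℕ} {a x : ℕ} (h : AscentAt (x :: w) a) (hne : a ≠ x) :
    AscentAt w a := by
  obtain ⟨ha, b, hb, hab, hi⟩ := h
  have hbx : b ≠ x := by
    rintro rfl
    exact not_idxOf_cons_lt_self hi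
  exact ⟨by simpa [hne] using ha, b, by simpa [hbx] using hb, hab, (idxOf_cons_lt hne hbx).1 hi⟩

theorem HasTriple.cons {w : List ℕ} {x : ℕ} (hx : x ∉ w) (h : HasTriple w) :
    HasTriple (x :: w) := by
  obtain ⟨a, ha, b, hb, c, hc, hab, hbc, h1, h2⟩ := h
  have hne : ∀ y ∈ w, y ≠ x := fun y hy he => hx (he ▸ hy)
  exact ⟨a, by simp [ha], b, by simp [hb], c, by simp [hc], hab, hbc,
    (idxOf_cons_lt (hne a ha) (hne b hb)).2 h1, (idxOf_cons_lt (hne b hb) (hne c hc)).2 h2⟩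

theorem AscentAt.hasTriple_cons {w : List ℕ} {x b : ℕ} (hx : x ∉ w) (h : AscentAt w b)
    (hxb : x < b) : HasTriple (x :: w) := by
  obtain ⟨hb, c, hc, hbc, hi⟩ := h
  have hne : ∀ y ∈ w, y ≠ x := fun y hy he => hx (he ▸ hy)
  exact ⟨x, by simp, b, by simp [hb], c, by simp [hc], hxb, hbc, idxOf_cons_self_lt (hne b hb),
    (idxOf_cons_lt (hne b hb) (hne c hc)).2 hi⟩

theorem HasTriple.of_cons {w : List ℕ} {x : ℕ} (h : HasTriple (x :: w)) :
    HasTriple w ∨ ∃ b, x < b ∧ AscentAt w b := by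
  obtain ⟨a, ha, b, hb, c, hc, hab, hbc, h1, h2⟩ := h
  have hbx : b ≠ x := by rintro rfl; exact not_idxOf_cons_lt_self h1
  have hcx : c ≠ x := by rintro rfl; exact not_idxOf_cons_lt_self h2
  have hb' : b ∈ w := by simpa [hbx] using hb
  have hc' : c ∈ w := by simpa [hcx] using hc
  have h2' := (idxOf_cons_lt hbx hcx).1 h2
  by_cases hax : a = x
  · exact Or.inr ⟨b, hax ▸ hab, hb', c, hc', hbc, h2'⟩
  · exact Or.inl ⟨a, by simpa [hax] using ha, b, hb', c, hc', hab, hbc,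
      (idxOf_cons_lt hax hbx).1 h1, h2'⟩

/-- The sets of entries `A`, `B` of the columns of the tableau of a word `w`, together with what they
tell about decreasing subsequences with letters in an interval and about ascents. -/
structure RSData (w : List ℕ) (A B : Finset ℕ) : Prop where
  valid : Valid A B
  union : A ∪ B = w.toFinset
  lower : ∀ a c b, a ≤ c → c ≤ b → ∃ X, DecIn w X ∧ (∀ t ∈ X, a ≤ t ∧ t < b) ∧
    cnt B c + cnt A b ≤ X.card + cnt B a + cnt A c
  upper : ∀ a b X, a ≤ b → DecIn w X → (∀ t ∈ X, a ≤ t ∧ t < b) → ∃ c, a ≤ c ∧ c ≤ b ∧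
    X.card + cnt B a + cnt A c ≤ cnt B c + cnt A b
  ascent : ∀ a ∈ A, ∀ b ∈ B, a < b → ∃ a', a ≤ a' ∧ AscentAt w a'
  of_ascent : ∀ a, AscentAt w a → ∃ a' ∈ A, ∃ b ∈ B, a ≤ a' ∧ a' < b

theorem RSData.nil : RSData [] ∅ ∅ where
  valid := Valid.empty
  union := by simp
  lower a c b _ _ := ⟨∅, ⟨by simp, by simp⟩, by simp, by simp⟩
  upper a b X hab hX _ := ⟨a, le_rfl, hab, by
    have : X = ∅ := Finset.eq_empty_of_forall_notMem fun x hx => by simpa using hX.1 x hx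
    simp [this]⟩
  ascent := by simp
  of_ascent a h := by simpa using h.1

theorem RSData.mem_iff {w : List ℕ} {A B : Finset ℕ} (h : RSData w A B) {t : ℕ} :
    t ∈ w ↔ t ∈ A ∨ t ∈ B := by
  rw [← Finset.mem_union, h.union, List.mem_toFinset]

/-- A decreasing subsequence that uses the new first letter `x` is `x` followed by one with letters
below `x`, so both bounds reduce to the interval `[a, x)`. -/
theorem RSData.cons_of_forall_lt {w : List ℕ} {A B : Finset ℕ} {x : ℕ} (h : RSData w A B)
    (hx : x ∉ w) (hx0 : 0 < x) (hlt : ∀ a ∈ A, a < x) : RSData (x :: w) (insert x A) B where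
  valid := by
    have hxAB : x ∉ A ∧ x ∉ B := by simpa [h.mem_iff] using hx
    refine ⟨by simp [h.valid.disj, hxAB.2], fun t ht => ?_, fun c => ?_⟩
    · rw [Finset.insert_union, Finset.mem_insert] at ht
      rcases ht with rfl | ht
      · exact hx0
      · exact h.valid.pos t ht
    · have := h.valid.ballot c
      rw [cnt_insert hxAB.1]
      omega
  union := by rw [Finset.insert_union, h.union]; simp
  lower a c b hac hcb := by
    have hxAB : x ∉ A ∧ x ∉ B := by simpa [h.mem_iff] using hx
    simp only [cnt_insert hxAB.1]
    -- Only in this case is the new entry counted. Since `A` lies below `x`, its entries in `[c, b)`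
    -- are those in `[c, x)`, and a decreasing set below `x` can be extended by `x`.
    by_cases hcx : c ≤ x ∧ x < b
    · obtain ⟨X, hX, hX1, hX2⟩ := h.lower a c x hac hcx.1
      refine ⟨insert x X, hX.cons_insert hx fun y hy => (hX1 y hy).2, fun t ht => ?_, ?_⟩
      · rcases Finset.mem_insert.1 ht with rfl | ht
        · omega
        · have := hX1 t ht; omega
      · rw [Finset.card_insert_of_notMem fun hxX => hx (hX.1 x hxX)]
        have := cnt_eq_of_gap (A := A) hcx.2.le fun t ht h1 => by
          have := hlt t ht; omega
        split_ifs <;> omega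
    · obtain ⟨X, hX, hX1, hX2⟩ := h.lower a c b hac hcb
      refine ⟨X, hX.cons hx, hX1, ?_⟩
      split_ifs <;> omega
  upper a b X hab hX hX1 := by
    have hxAB : x ∉ A ∧ x ∉ B := by simpa [h.mem_iff] using hx
    simp only [cnt_insert hxAB.1]
    by_cases hxX : x ∈ X
    · obtain ⟨c, hac, hcb, hc⟩ := h.upper a x (X.erase x) (hX1 x hxX).1
        ((hX.mono (Finset.erase_subset _ _)).of_cons (Finset.notMem_erase _ _)) fun t ht =>
          ⟨(hX1 t (Finset.mem_of_mem_erase ht)).1,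
            hX.lt_of_cons hxX (Finset.mem_of_mem_erase ht) (Finset.ne_of_mem_erase ht)⟩
      have h1 := Finset.card_erase_add_one hxX
      have h2 := hX1 x hxX
      have h3 := cnt_mono A h2.2.le
      refine ⟨c, hac, by omega, ?_⟩
      split_ifs <;> omega
    · obtain ⟨c, hac, hcb, hc⟩ := h.upper a b X hab (hX.of_cons hxX) hX1
      refine ⟨c, hac, hcb, ?_⟩
      split_ifs <;> omega
  ascent a ha b hb hab := by
    rcases Finset.mem_insert.1 ha with rfl | ha
    · exact ⟨a, le_rfl, ascentAt_cons_self (h.mem_iff.2 (Or.inr hb)) hab⟩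
    · obtain ⟨a', h1, h2⟩ := h.ascent a ha b hb hab
      exact ⟨a', h1, h2.cons hx⟩
  of_ascent a ha := by
    by_cases hax : a = x
    · subst hax
      obtain ⟨_, c, hc, hac, _⟩ := ha
      have hc' : c ∈ w := by
        have : c ≠ a := by omega
        simpa [this] using hc
      rcases h.mem_iff.1 hc' with hcA | hcB
      · have := hlt c hcA; omega
      · exact ⟨a, Finset.mem_insert_self _ _, c, hcB, le_rfl, hac⟩
    · obtain ⟨a', h1, b, hb, h2⟩ := h.of_ascent a (ha.of_cons hax)
      exact ⟨a', Finset.mem_insert_of_mem h1, b, hb, h2⟩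

/-- `A` has no entry in `[x, z)` and `B` none from `z` on. So the counts change only through the
positions of `x` and `z`, and where the old split point `c` fails, the split at `z` or `z + 1`
works. -/
theorem RSData.cons_of_bump {w : List ℕ} {A B : Finset ℕ} {x z : ℕ} (h : RSData w A B)
    (hx : x ∉ w) (hx0 : 0 < x) (hz : z ∈ A) (hxz : x < z) (hgap : ∀ a ∈ A, a < z → a < x)
    (hB : ∀ b ∈ B, b < z) : RSData (x :: w) (insert x (A.erase z)) (insert z B) := by
  have hxAB : x ∉ A ∧ x ∉ B := by simpa [h.mem_iff] using hx
  have hzB : z ∉ B := h.valid.notMem_right hz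
  have hxA' : x ∉ A.erase z := fun h => hxAB.1 (Finset.mem_of_mem_erase h)
  have hA' : ∀ c, cnt (insert x (A.erase z)) c + (if z < c then 1 else 0) =
      cnt A c + if x < c then 1 else 0 := fun c => by
    have h1 := cnt_erase hz c
    rw [cnt_insert hxA']
    omega
  have hB' : ∀ c, cnt (insert z B) c = cnt B c + if z < c then 1 else 0 := fun c => cnt_insert hzB c
  have hzw : z ∈ w := h.mem_iff.2 (Or.inl hz)
  have hgapA : ∀ c, x ≤ c → c ≤ z → cnt A c = cnt A z := fun c h1 h2 =>
    cnt_eq_of_gap h2 fun t ht h3 => by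
      by_contra h4
      have := hgap t ht (by omega)
      omega
  have hgapB : ∀ c d, z ≤ c → c ≤ d → cnt B c = cnt B d := fun c d h1 h2 =>
    cnt_eq_of_gap h2 fun t ht h3 => by have := hB t ht; omega
  have hzA : cnt A (z + 1) = cnt A z + 1 := by rw [cnt_succ, if_pos hz]
  constructor
  case valid =>
    refine ⟨?_, fun t ht => ?_, fun c => ?_⟩
    · rw [Finset.disjoint_left]
      intro t ht ht'
      rcases Finset.mem_insert.1 ht with rfl | ht <;> rcases Finset.mem_insert.1 ht' with rfl | ht'
      · omega
      · exact hxAB.2 ht'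
      · exact Finset.notMem_erase _ _ ht
      · exact h.valid.notMem_right (Finset.mem_of_mem_erase ht) ht'
    · have : t = x ∨ t ∈ A ∪ B := by
        simp only [Finset.mem_union, Finset.mem_insert, Finset.mem_erase] at ht ⊢
        rcases ht with (h1 | h1) | h1 | h1
        · exact Or.inl h1
        · exact Or.inr (Or.inl h1.2)
        · exact Or.inr (Or.inl (h1 ▸ hz))
        · exact Or.inr (Or.inr h1)
      rcases this with rfl | ht
      · exact hx0
      · exact h.valid.pos t ht
    · have h1 := h.valid.ballot c
      have h2 := h.valid.ballot z
      have h3 := hA' c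
      have h4 := hB' c
      by_cases hzc : z < c
      · have h5 := cnt_mono A (show z + 1 ≤ c from hzc)
        have h6 := hgapB z c le_rfl hzc.le
        rw [if_pos hzc] at h3 h4
        rw [if_pos (by omega)] at h3
        omega
      · rw [if_neg hzc] at h3 h4
        omega
  case union =>
    rw [Finset.insert_union, Finset.union_insert, ← Finset.insert_union, Finset.insert_erase hz,
      h.union]
    simp
  case lower =>
    intro a c b hac hcb
    have ha1 := hA' b
    have hc1 := hA' c
    have ha2 := hB' a
    have hc2 := hB' c
    by_cases hcx : c ≤ x ∧ x < b ∧ b ≤ z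
    · obtain ⟨X, hX, hX1, hX2⟩ := h.lower a c x hac hcx.1
      refine ⟨insert x X, hX.cons_insert hx fun y hy => (hX1 y hy).2, fun t ht => ?_, ?_⟩
      · rcases Finset.mem_insert.1 ht with rfl | ht
        · omega
        · have := hX1 t ht; omega
      · rw [Finset.card_insert_of_notMem fun hxX => hx (hX.1 x hxX)]
        have h1 := hgapA b (by omega) hcx.2.2
        have h2 := hgapA x le_rfl hxz.le
        split_ifs at ha1 hc1 ha2 hc2 <;> omega
    -- The new second column counts `z`. Before the insertion `z` was in `A`, so the split at `z`
    -- counts it too, and `B` has nothing between `z` and `c`.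
    · by_cases hc : z < c ∧ a ≤ z
      · obtain ⟨X, hX, hX1, hX2⟩ := h.lower a z b hc.2 (by omega)
        refine ⟨X, hX.cons hx, hX1, ?_⟩
        have h1 := hgapB z c le_rfl hc.1.le
        have h2 := cnt_mono A (show z + 1 ≤ c from hc.1)
        split_ifs at ha1 hc1 ha2 hc2 <;> omega
      · obtain ⟨X, hX, hX1, hX2⟩ := h.lower a c b hac hcb
        refine ⟨X, hX.cons hx, hX1, ?_⟩
        split_ifs at ha1 hc1 ha2 hc2 <;> omega
  case upper =>
    intro a b X hab hX hX1
    have ha1 := hA' b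
    have ha2 := hB' a
    by_cases hxX : x ∈ X
    · obtain ⟨c, hac, hcb, hc⟩ := h.upper a x (X.erase x) (hX1 x hxX).1
        ((hX.mono (Finset.erase_subset _ _)).of_cons (Finset.notMem_erase _ _)) fun t ht =>
          ⟨(hX1 t (Finset.mem_of_mem_erase ht)).1,
            hX.lt_of_cons hxX (Finset.mem_of_mem_erase ht) (Finset.ne_of_mem_erase ht)⟩
      have h1 := Finset.card_erase_add_one hxX
      have h2 := hX1 x hxX
      have h3 := cnt_mono A h2.2.le
      have h4 := hgapA x le_rfl hxz.le
      have hc1 := hA' c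
      have hc2 := hB' c
      refine ⟨c, hac, by omega, ?_⟩
      by_cases hzb : z < b
      · have h5 := cnt_mono A (show z + 1 ≤ b from hzb)
        split_ifs at ha1 hc1 ha2 hc2 <;> omega
      · split_ifs at ha1 hc1 ha2 hc2 <;> omega
    · obtain ⟨c, hac, hcb, hc⟩ := h.upper a b X hab (hX.of_cons hxX) hX1
      by_cases hs : c ≤ z ∧ z < b ∧ (c ≤ x → x < a)
      · have hc1 := hA' (z + 1)
        have hc2 := hB' (z + 1)
        refine ⟨z + 1, by omega, by omega, ?_⟩
        have h1 := cnt_mono B (show c ≤ z + 1 by omega)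
        have h2 := hgapA c (by omega) hs.1
        split_ifs at ha1 hc1 ha2 hc2 <;> omega
      · have hc1 := hA' c
        have hc2 := hB' c
        refine ⟨c, hac, hcb, ?_⟩
        split_ifs at ha1 hc1 ha2 hc2 <;> omega
  case ascent =>
    intro a ha b hb hab
    rcases Finset.mem_insert.1 ha with rfl | ha
    · exact ⟨a, le_rfl, ascentAt_cons_self hzw hxz⟩
    · rcases Finset.mem_insert.1 hb with rfl | hb
      · have := hgap a (Finset.mem_of_mem_erase ha) hab
        exact ⟨x, by omega, ascentAt_cons_self hzw hxz⟩
      · obtain ⟨a', h1, h2⟩ := h.ascent a (Finset.mem_of_mem_erase ha) b hb hab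
        exact ⟨a', h1, h2.cons hx⟩
  case of_ascent =>
    intro a ha
    -- The pair `x`, `z` serves all ascents: an older one starts at or below an entry of `A` that is
    -- less than some entry of `B`, hence less than `z`, hence less than `x`.
    refine ⟨x, Finset.mem_insert_self _ _, z, Finset.mem_insert_self _ _, ?_, hxz⟩
    by_cases hax : a = x
    · exact hax.le
    · obtain ⟨a', h1, b, hb, h2⟩ := h.of_ascent a (ha.of_cons hax)
      have h3 := hB b hb
      have h4 := hgap a' h1 (by omega)
      omega

/-- The tableau of a word has at most two columns if and only if the word has no increasing
subsequence of length three. -/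
theorem rsTableau_cases {w : List ℕ} (hw : w.Nodup) (hpos : ∀ t ∈ w, 0 < t) :
    (∃ A B, rsTableau w = cols A B ∧ RSData w A B ∧ ¬ HasTriple w) ∨
      (3 ≤ (rsTableau w).length ∧ HasTriple w) := by
  induction w with
  | nil => exact Or.inl ⟨∅, ∅, by rw [cols_empty]; rfl, RSData.nil, by simp [HasTriple]⟩
  | cons x w ih =>
    rw [List.nodup_cons] at hw
    have hx := hw.1
    have hx0 := hpos x (by simp)
    have hr : rsTableau (x :: w) = tabInsert x (rsTableau w) := rfl
    rw [hr]
    rcases ih hw.2 fun t ht => hpos t (by simp [ht]) with ⟨A, B, h1, h2, h3⟩ | ⟨h1, h2⟩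
    · rw [h1]
      have hxAB : x ∉ A ∧ x ∉ B := by simpa [h2.mem_iff] using hx
      rcases insert_cases hxAB.1 with hlt | ⟨z, hz, hxz, hgap⟩
      · refine Or.inl ⟨_, _, tabInsert_cols_of_forall_lt h2.valid.right_eq_empty hlt,
          h2.cons_of_forall_lt hx hx0 hlt, fun ht => ?_⟩
        rcases ht.of_cons with ht | ⟨b, hxb, hb⟩
        · exact h3 ht
        · obtain ⟨a', ha', b', hb', h4, h5⟩ := h2.of_ascent b hb
          have := hlt a' ha'
          omega
      · by_cases hB : ∀ b ∈ B, b < z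
        · refine Or.inl ⟨_, _, tabInsert_cols_of_bump hxAB.1 hz hxz hgap hB,
            h2.cons_of_bump hx hx0 hz hxz hgap hB, fun ht => ?_⟩
          rcases ht.of_cons with ht | ⟨b, hxb, hb⟩
          · exact h3 ht
          · obtain ⟨a', ha', b', hb', h4, h5⟩ := h2.of_ascent b hb
            have := hB b' hb'
            have := hgap a' ha' (by omega)
            omega
        · push Not at hB
          obtain ⟨b, hb, hzb⟩ := hB
          have hzb' : z < b := by
            have : z ≠ b := fun he => h2.valid.notMem_right hz (he ▸ hb)
            omega
          -- A third column appears exactly when `x` is below the start of some ascent, and `x`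
          -- followed by that ascent is the triple.
          obtain ⟨a', h4, h5⟩ := h2.ascent z hz b hb hzb'
          exact Or.inr ⟨three_le_length_tabInsert hxAB.1 hz hxz hgap hb hzb',
            h5.hasTriple_cons hx (by omega)⟩
    · exact Or.inr ⟨h1.trans (length_le_length_tabInsert _ _), h2.cons hx⟩

theorem flatten_tabInsert_perm (x : ℕ) (T : List (List ℕ)) :
    (tabInsert x T).flatten.Perm (x :: T.flatten) := by
  have key : ∀ (x : ℕ) (C : List ℕ),
      ((colInsert x C).1 ++ (colInsert x C).2.toList).Perm (x :: C) := by
    intro x C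
    induction C with
    | nil => simp [colInsert]
    | cons a C ih =>
      rw [colInsert]
      split_ifs
      · simp
      · exact (ih.cons a).trans (List.Perm.swap x a C)
  induction T generalizing x with
  | nil => simp [tabInsert]
  | cons C T ih =>
    have h1 := key x C
    rw [tabInsert]
    rcases h : colInsert x C with ⟨C', _ | k⟩
    · rw [h] at h1
      simpa using h1.append_right T.flatten
    · rw [h] at h1
      have h2 := h1.append_right T.flatten
      simp only [Option.toList_some, List.append_assoc, List.cons_append, List.nil_append] at h2
      exact ((ih k).append_left C').trans h2

theorem flatten_rsTableau_perm (w : List ℕ) : (rsTableau w).flatten.Perm w := by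
  induction w with
  | nil => simp [rsTableau]
  | cons x w ih => exact (flatten_tabInsert_perm x _).trans (ih.cons x)

/-! ### The weak order on words -/

theorem WeakLE.refl {w : List ℕ} (h : w.Nodup) : WeakLE w w :=
  ⟨h, List.Perm.refl _, fun _ _ _ _ _ h => h⟩

theorem WeakLE.trans {w y v : List ℕ} (h : WeakLE w y) (h' : WeakLE y v) : WeakLE w v :=
  ⟨h.1, h.2.1.trans h'.2.1, fun a ha b hb hab hi =>
    h'.2.2 a (h.2.1.mem_iff.1 ha) b (h.2.1.mem_iff.1 hb) hab (h.2.2 a ha b hb hab hi)⟩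

theorem WeakLE.cons {w y : List ℕ} {x : ℕ} (h : WeakLE w y) (hx : x ∉ w) :
    WeakLE (x :: w) (x :: y) := by
  refine ⟨List.nodup_cons.2 ⟨hx, h.1⟩, h.2.1.cons x, fun a ha b hb hab hi => ?_⟩
  by_cases hax : a = x
  · subst hax
    exact absurd hi not_idxOf_cons_lt_self
  · by_cases hbx : b = x
    · subst hbx
      exact idxOf_cons_self_lt hax
    · rw [idxOf_cons_lt hbx hax] at hi ⊢
      exact h.2.2 a (by simpa [hax] using ha) b (by simpa [hbx] using hb) hab hi

theorem WeakLE.append_left {w y : List ℕ} (h : WeakLE w y) :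
    ∀ {u : List ℕ}, (u ++ w).Nodup → WeakLE (u ++ w) (u ++ y)
  | [], _ => h
  | x :: u, hu => by
    rw [List.cons_append, List.nodup_cons] at hu
    exact (h.append_left hu.2).cons hu.1

theorem weakLE_swap {x j : ℕ} {r : List ℕ} (hxj : x < j) (h : (x :: j :: r).Nodup) :
    WeakLE (x :: j :: r) (j :: x :: r) := by
  refine ⟨h, List.Perm.swap j x r, fun a ha b hb hab hi => ?_⟩
  simp only [List.idxOf_cons, beq_iff_eq, cond_eq_ite] at hi ⊢
  split_ifs at hi ⊢ <;> omega

/-- `j` jumps over the letters of `v` one at a time; all are smaller, so every exchange creates an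
inversion. -/
theorem weakLE_move {j : ℕ} {r : List ℕ} : ∀ {v : List ℕ}, (∀ x ∈ v, x < j) →
    (v ++ j :: r).Nodup → WeakLE (v ++ j :: r) (j :: (v ++ r))
  | [], _, h => WeakLE.refl h
  | x :: v, hv, h => by
    rw [List.cons_append] at h ⊢
    have h1 := List.nodup_cons.1 h
    have h2 := (weakLE_move (fun y hy => hv y (by simp [hy])) h1.2).cons h1.1
    exact h2.trans (weakLE_swap (hv x (by simp)) (h2.2.1.nodup_iff.1 h))

theorem WeakLE.not_hasTriple {w y : List ℕ} (h : WeakLE w y) (hw : ¬ HasTriple w) :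
    ¬ HasTriple y := by
  rintro ⟨a, ha, b, hb, c, hc, hab, hbc, h1, h2⟩
  have key : ∀ a ∈ y, ∀ b ∈ y, a < b → y.idxOf a < y.idxOf b → w.idxOf a < w.idxOf b := by
    intro a ha b hb hab hi
    have ha' := h.2.1.mem_iff.2 ha
    have hb' := h.2.1.mem_iff.2 hb
    by_contra hn
    have hne : w.idxOf a ≠ w.idxOf b := fun he => by
      have := (List.idxOf_inj ha').1 he
      omega
    have := h.2.2 a ha' b hb' hab (by omega)
    omega
  exact hw ⟨a, h.2.1.mem_iff.2 ha, b, h.2.1.mem_iff.2 hb, c, h.2.1.mem_iff.2 hc, hab, hbc,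
    key a ha b hb hab h1, key b hb c hc hbc h2⟩

theorem WeakLE.decIn {w y : List ℕ} (h : WeakLE w y) {X : Finset ℕ} (hX : DecIn w X) :
    DecIn y X :=
  ⟨fun x hx => h.2.1.mem_iff.1 (hX.1 x hx), fun x hx z hz hxz =>
    h.2.2 x (hX.1 x hx) z (hX.1 z hz) hxz (hX.2 x hx z hz hxz)⟩

/-! ### The induced weak order on two-column tableaux -/

/-- For a two-column tableau: the projection to the interval `[a, b)` has a first column of length at
most `k`. -/
def MaxLE (A B : Finset ℕ) (a b k : ℕ) : Prop :=
  ∀ c, a ≤ c → c ≤ b → cnt B c + cnt A b ≤ k + cnt B a + cnt A c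

/-- At most two columns means no increasing triple, and this property is inherited upwards in the
weak order. -/
theorem exists_rsData_of_weakLE {w y : List ℕ} {A B : Finset ℕ} (h : WeakLE w y)
    (hv : Valid A B) (hw : rsTableau w = cols A B) :
    RSData w A B ∧ ∃ A' B', rsTableau y = cols A' B' ∧ RSData y A' B' := by
  have hpos : ∀ t ∈ w, 0 < t := fun t ht =>
    hv.pos t (mem_flatten_cols.1 (hw ▸ (flatten_rsTableau_perm w).mem_iff.2 ht))
  rcases rsTableau_cases h.1 hpos with ⟨A₁, B₁, h1, h2, h3⟩ | ⟨h1, h2⟩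
  · obtain ⟨rfl, rfl⟩ := hv.cols_inj h2.valid (hw.symm.trans h1)
    refine ⟨h2, ?_⟩
    rcases rsTableau_cases (h.2.1.nodup_iff.1 h.1) fun t ht => hpos t (h.2.1.mem_iff.2 ht) with
      ⟨A', B', h4, h5, h6⟩ | ⟨h4, h5⟩
    · exact ⟨A', B', h4, h5⟩
    · exact absurd h5 (h.not_hasTriple h3)
  · have := cols_length_le A B
    rw [hw] at h1
    omega

theorem RSData.union_eq {w y : List ℕ} {A B A' B' : Finset ℕ} (h : RSData w A B)
    (h' : RSData y A' B') (hp : w.Perm y) : A ∪ B = A' ∪ B' := by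
  rw [h.union, h'.union, List.toFinset_eq_of_perm _ _ hp]

/-- A decreasing subsequence of `w` that attains the count at `c` stays decreasing in `y`, where it
is bounded by the count at some `d`. -/
theorem RSData.maxLE {w y : List ℕ} {A B A' B' : Finset ℕ} (h : RSData w A B)
    (h' : RSData y A' B') (hle : WeakLE w y) {a b k : ℕ} (hk : MaxLE A' B' a b k) :
    MaxLE A B a b k := by
  intro c hac hcb
  obtain ⟨X, hX, hX1, hX2⟩ := h.lower a c b hac hcb
  obtain ⟨d, had, hdb, hd⟩ := h'.upper a b X (hac.trans hcb) (hle.decIn hX) hX1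
  have := hk d had hdb
  omega

theorem DufloLE.exists_cols {A B : Finset ℕ} {S : List (List ℕ)} (h : DufloLE (cols A B) S)
    (hv : Valid A B) : ∃ A' B', Valid A' B' ∧ S = cols A' B' ∧ A ∪ B = A' ∪ B' ∧
      ∀ a b k, MaxLE A' B' a b k → MaxLE A B a b k := by
  replace h := h.2.2
  induction h with
  | refl => exact ⟨A, B, hv, rfl, rfl, fun _ _ _ h => h⟩
  | tail _ hs ih =>
    obtain ⟨A₁, B₁, hv₁, rfl, hu, hm⟩ := ih
    obtain ⟨_, _, w, y, hw, hy, hle⟩ := hs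
    obtain ⟨hd, A', B', hy', hd'⟩ := exists_rsData_of_weakLE hle hv₁ hw
    exact ⟨A', B', hd'.valid, hy.symm.trans hy', hu.trans (hd.union_eq hd' hle.2.1),
      fun a b k h => hm a b k (hd.maxLE hd' hle h)⟩

theorem DufloLE.refl {T : List (List ℕ)} (h : IsTableau T) : DufloLE T T :=
  ⟨h, h, Relation.ReflTransGen.refl⟩

theorem DufloLE.trans {T S R : List (List ℕ)} (h : DufloLE T S) (h' : DufloLE S R) :
    DufloLE T R :=
  ⟨h.1, h'.2.1, h.2.2.trans h'.2.2⟩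

theorem DufloLE.of_weakLE {w y : List ℕ} {T S : List (List ℕ)} (hT : IsTableau T)
    (hS : IsTableau S) (hw : rsTableau w = T) (hy : rsTableau y = S) (h : WeakLE w y) :
    DufloLE T S :=
  ⟨hT, hS, Relation.ReflTransGen.single ⟨hT, hS, w, y, hw, hy, h⟩⟩

/-- Insertion of a letter is monotone. -/
theorem DufloLE.tabInsert {A B A₁ B₁ : Finset ℕ} {S : List (List ℕ)} {x : ℕ}
    (h : DufloLE (cols A B) S) (hv : Valid A B) (hx : x ∉ A ∪ B) (hv₁ : Valid A₁ B₁)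
    (he : YoungTab.tabInsert x (cols A B) = cols A₁ B₁) :
    DufloLE (cols A₁ B₁) (YoungTab.tabInsert x S) := by
  replace h := h.2.2
  -- The induction has to carry along that each tableau of the chain has at most two columns before
  -- and after the insertion of `x`; this is what lets `exists_rsData_of_weakLE` be applied to `x ::
  -- w`.
  suffices ∃ A' B' A₁' B₁', Valid A' B' ∧ Valid A₁' B₁' ∧ S = cols A' B' ∧ A ∪ B = A' ∪ B' ∧
      YoungTab.tabInsert x S = cols A₁' B₁' ∧ DufloLE (cols A₁ B₁) (YoungTab.tabInsert x S) by
    obtain ⟨_, _, _, _, _, _, _, _, _, h⟩ := this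
    exact h
  induction h with
  | refl => exact ⟨A, B, A₁, B₁, hv, hv₁, rfl, rfl, he, by rw [he]; exact DufloLE.refl hv₁.isTableau⟩
  | tail _ hs ih =>
    obtain ⟨A', B', A₁', B₁', hv', hv₁', rfl, hu, he', hle'⟩ := ih
    obtain ⟨_, _, w, y, hw, hy, hle⟩ := hs
    obtain ⟨hd, A'', B'', hy', hd'⟩ := exists_rsData_of_weakLE hle hv' hw
    have hxw : x ∉ w := by
      rw [hu] at hx
      simpa [hd.mem_iff] using hx
    have hle2 := hle.cons hxw
    have hw2 : rsTableau (x :: w) = cols A₁' B₁' := by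
      rw [← he', ← hw]; rfl
    obtain ⟨_, A₁'', B₁'', hy2, hd2⟩ := exists_rsData_of_weakLE hle2 hv₁' hw2
    have hy3 : YoungTab.tabInsert x (cols A'' B'') = cols A₁'' B₁'' := by
      rw [← hy2, ← hy']; rfl
    rw [hy.symm.trans hy']
    refine ⟨A'', B'', A₁'', B₁'', hd'.valid, hd2.valid, rfl, hu.trans (hd.union_eq hd' hle.2.1),
      hy3, hle'.trans ?_⟩
    rw [hy3, he']
    exact DufloLE.of_weakLE hv₁'.isTableau hd2.valid.isTableau hw2 hy2 hle2

/-! ### Words of two-column tableaux -/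

/-- `R` is waiting in the first column below `P`. The letters of `l` arrive smallest first; each
bumps the top remaining entry of `R`, which settles at the bottom of the second column. When `R` is
used up, the rest of `l` is appended. -/
theorem foldr_tabInsert_reverse : ∀ {l R : List ℕ} {P Q : Finset ℕ}, l.Pairwise (· < ·) →
    R.Pairwise (· < ·) → R.length ≤ l.length →
    (∀ (i : ℕ) (hl : i < l.length) (hR : i < R.length), l[i] < R[i]) →
    (P = ∅ → Q = ∅) → (∀ p ∈ P, ∀ x ∈ l, p < x) → (∀ p ∈ P, ∀ x ∈ R, p < x) →
    (∀ q ∈ Q, ∀ x ∈ R, q < x) →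
    l.reverse.foldr tabInsert (cols (P ∪ R.toFinset) Q) =
      cols (P ∪ l.toFinset) (Q ∪ R.toFinset)
  | [], R, P, Q, _, _, hR, _, _, _, _, _ => by
    have : R = [] := by simpa using hR
    subst this
    simp
  | x :: l, [], P, Q, hl, hR, hlen, hrow, hPQ, hPl, hPR, hQR => by
    rw [List.reverse_cons, List.foldr_append, List.foldr_cons, List.foldr_nil,
      tabInsert_cols_of_forall_lt (by simpa using hPQ)
        (fun a ha => hPl a (by simpa using ha) x (by simp))]
    rw [List.pairwise_cons] at hl
    have h1 := foldr_tabInsert_reverse (l := l) (R := []) (P := insert x P) (Q := Q) hl.2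
      List.Pairwise.nil (by simp) (by simp) (by simp) (fun p hp y hy => by
        rcases Finset.mem_insert.1 hp with rfl | hp
        · exact hl.1 y hy
        · exact hPl p hp y (by simp [hy])) (by simp) (by simp)
    simp only [List.toFinset_nil, Finset.union_empty] at h1 ⊢
    rw [h1]
    congr 1
    ext t
    simp only [Finset.mem_union, Finset.mem_insert, List.toFinset_cons]
    tauto
  | x :: l, z :: R, P, Q, hl, hR, hlen, hrow, hPQ, hPl, hPR, hQR => by
    have hxz : x < z := hrow 0 (by simp) (by simp)
    rw [List.pairwise_cons] at hl hR
    have hxP : ∀ p ∈ P, p < x := fun p hp => hPl p hp x (by simp)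
    have hzP : ∀ p ∈ P, p < z := fun p hp => hPR p hp z (by simp)
    have hxA : x ∉ P ∪ (z :: R).toFinset := by
      intro h
      simp only [Finset.mem_union, List.mem_toFinset, List.mem_cons] at h
      rcases h with h | h | h
      · have := hxP x h; omega
      · omega
      · have := hR.1 x h; omega
    rw [List.reverse_cons, List.foldr_append, List.foldr_cons, List.foldr_nil,
      tabInsert_cols_of_bump hxA (by simp) hxz (fun a ha haz => by
        simp only [Finset.mem_union, List.mem_toFinset, List.mem_cons] at ha
        rcases ha with h | h | h
        · exact hxP a h
        · omega
        · have := hR.1 a h; omega) (fun b hb => hQR b hb z (by simp))]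
    have h1 := foldr_tabInsert_reverse (l := l) (R := R) (P := insert x P) (Q := insert z Q) hl.2
      hR.2 (by simpa using hlen)
      (fun i h h' => hrow (i + 1) (Nat.succ_lt_succ h) (Nat.succ_lt_succ h')) (by simp)
      (fun p hp y hy => by
        rcases Finset.mem_insert.1 hp with rfl | hp
        · exact hl.1 y hy
        · exact hPl p hp y (by simp [hy]))
      (fun p hp y hy => by
        rcases Finset.mem_insert.1 hp with rfl | hp
        · exact hxz.trans (hR.1 y hy)
        · exact hPR p hp y (by simp [hy]))
      (fun q hq y hy => by
        rcases Finset.mem_insert.1 hq with rfl | hq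
        · exact hR.1 y hy
        · exact hQR q hq y (by simp [hy]))
    have h2 : insert x ((P ∪ (z :: R).toFinset).erase z) = insert x P ∪ R.toFinset := by
      ext t
      simp only [Finset.mem_union, Finset.mem_insert, Finset.mem_erase, List.mem_toFinset,
        List.mem_cons]
      constructor
      · rintro (h | ⟨h, h' | h' | h'⟩)
        · exact Or.inl (Or.inl h)
        · exact Or.inl (Or.inr h')
        · exact absurd h' h
        · exact Or.inr h'
      · rintro ((h | h) | h)
        · exact Or.inl h
        · have := hzP t h
          exact Or.inr ⟨by omega, Or.inl h⟩
        · have := hR.1 t h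
          exact Or.inr ⟨by omega, Or.inr (Or.inr h)⟩
    rw [h2, h1]
    congr 1
    · ext t
      simp only [Finset.mem_union, Finset.mem_insert, List.toFinset_cons]
      tauto
    · ext t
      simp only [Finset.mem_union, Finset.mem_insert, List.toFinset_cons]
      tauto

theorem foldr_tabInsert_cols {A B P Q : Finset ℕ} (hv : Valid A B) (hPQ : P = ∅ → Q = ∅)
    (hP : ∀ p ∈ P, ∀ x ∈ A ∪ B, p < x) (hQ : ∀ q ∈ Q, ∀ x ∈ A ∪ B, q < x) :
    (A.sort.reverse ++ B.sort.reverse).foldr tabInsert (cols P Q) = cols (P ∪ A) (Q ∪ B) := by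
  have h1 := foldr_tabInsert_reverse (l := B.sort) (R := []) (P := P) (Q := Q) (pairwise_sort B)
    List.Pairwise.nil (by simp) (by simp) hPQ
    (fun p hp x hx => hP p hp x (Finset.mem_union_right _ ((Finset.mem_sort _).1 hx)))
    (by simp) (by simp)
  have hr := rows_of_countP_le (pairwise_sort A) (pairwise_sort B)
      (fun x hx hx' => hv.notMem_right ((Finset.mem_sort _).1 hx) ((Finset.mem_sort _).1 hx'))
      (fun c => by rw [← cnt_eq_countP, ← cnt_eq_countP]; exact hv.ballot c)
  have h2 := foldr_tabInsert_reverse (l := A.sort) (R := B.sort) (P := P) (Q := Q)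
    (pairwise_sort A) (pairwise_sort B) hr.1 hr.2 hPQ
    (fun p hp x hx => hP p hp x (Finset.mem_union_left _ ((Finset.mem_sort _).1 hx)))
    (fun p hp x hx => hP p hp x (Finset.mem_union_right _ ((Finset.mem_sort _).1 hx)))
    (fun q hq x hx => hQ q hq x (Finset.mem_union_right _ ((Finset.mem_sort _).1 hx)))
  simp only [List.toFinset_nil, Finset.union_empty, Finset.sort_toFinset] at h1 h2
  rw [List.foldr_append, h1, h2]

/-- The lower block is inserted first; the larger letters then only build below it, so the two
tableaux are stacked column by column. -/
theorem rsTableau_of_split {A B A' B' : Finset ℕ} (hv : Valid A B) (hv' : Valid A' B')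
    (h : ∀ p ∈ A ∪ B, ∀ x ∈ A' ∪ B', p < x) :
    rsTableau ((A'.sort.reverse ++ B'.sort.reverse) ++ (A.sort.reverse ++ B.sort.reverse)) =
      cols (A ∪ A') (B ∪ B') := by
  have h1 := foldr_tabInsert_cols (P := ∅) (Q := ∅) hv (by simp) (by simp) (by simp)
  rw [rsTableau, List.foldr_append, ← cols_empty, h1]
  simp only [Finset.empty_union]
  exact foldr_tabInsert_cols hv' hv.right_eq_empty
    (fun p hp => h p (Finset.mem_union_left _ hp)) (fun p hp => h p (Finset.mem_union_right _ hp))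

/-- An entry `j` of the second column such that the entries greater than `j` form a tableau can be
moved to the first column. -/
theorem dufloLE_move {A B : Finset ℕ} {j : ℕ} (hv : Valid A B) (hj : j ∈ B)
    (hb : ∀ c, j < c → cnt B c + cnt A j ≤ cnt A c + cnt B j + 1) :
    Valid (insert j A) (B.erase j) ∧ DufloLE (cols A B) (cols (insert j A) (B.erase j)) := by
  have hjA : j ∉ A := fun h => hv.notMem_right h hj
  have hvm : Valid (insert j A) (B.erase j) := by
    refine ⟨?_, fun t ht => hv.pos t ?_, fun c => ?_⟩
    · rw [Finset.disjoint_insert_left]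
      exact ⟨Finset.notMem_erase _ _, hv.disj.mono_right (Finset.erase_subset _ _)⟩
    · rwa [Finset.insert_union, ← Finset.union_insert, Finset.insert_erase hj] at ht
    · have h1 := cnt_erase hj c
      have h2 := hv.ballot c
      rw [cnt_insert hjA]
      split_ifs at h1 ⊢ <;> omega
  refine ⟨hvm, ?_⟩
  -- The word of the block above `j`, then `A₁` decreasing, `j`, `B₁` decreasing, has tableau `A`,
  -- `B`; with `j` in front of `A₁` it has the moved tableau. The hypothesis `hb` makes the block
  -- above `j` a tableau; its summand `1` accounts for `j` itself, counted in `cnt B c` but not in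
  -- `cnt B j`.
  set A₁ := A.filter (· < j) with hA₁
  set B₁ := B.filter (· < j) with hB₁
  set A₂ := A.filter (j < ·) with hA₂
  set B₂ := B.filter (j < ·) with hB₂
  have hcnt₁ : ∀ (C : Finset ℕ) c, cnt (C.filter (· < j)) c = cnt C (min c j) := fun C c => by
    unfold cnt
    rw [Finset.filter_filter]
    congr 1
    ext t
    simp only [Finset.mem_filter, lt_min_iff]
    tauto
  have hcnt₂ : ∀ (C : Finset ℕ) c, cnt (C.filter (j < ·)) c + cnt C (min c (j + 1)) = cnt C c := by
    intro C c
    by_cases hc : j + 1 ≤ c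
    · rw [min_eq_right hc, ← cnt_filter_Ico C hc]
      congr 1
      unfold cnt
      rw [Finset.filter_filter]
      rfl
    · rw [min_eq_left (by omega), cnt_eq_zero, zero_add]
      intro t ht
      rw [Finset.mem_filter] at ht
      omega
  have hjA₁ : j ∉ A₁ := by simp [hA₁]
  have hjB₁ : j ∉ B₁ := by simp [hB₁]
  have hsA : cnt A (j + 1) = cnt A j := by rw [cnt_succ, if_neg hjA, add_zero]
  have hsB : cnt B (j + 1) = cnt B j + 1 := by rw [cnt_succ, if_pos hj]
  have hbj := hv.ballot (j + 1)
  have hv₂ : Valid A₂ B₂ := by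
    refine ⟨Finset.disjoint_filter_filter hv.disj, fun t ht => hv.pos t ?_, fun c => ?_⟩
    · exact Finset.union_subset_union (Finset.filter_subset _ _) (Finset.filter_subset _ _) ht
    · have h1 := hcnt₂ A c
      have h2 := hcnt₂ B c
      rw [← hA₂] at h1
      rw [← hB₂] at h2
      by_cases hc : j + 1 ≤ c
      · rw [min_eq_right hc] at h1 h2
        have h3 := hb c (by omega)
        omega
      · rw [min_eq_left (by omega)] at h1 h2
        omega
  have hv₁ : Valid A₁ (insert j B₁) := by
    refine ⟨?_, fun t ht => hv.pos t ?_, fun c => ?_⟩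
    · rw [Finset.disjoint_insert_right]
      exact ⟨hjA₁, Finset.disjoint_filter_filter hv.disj⟩
    · simp only [hA₁, hB₁, Finset.mem_union, Finset.mem_insert, Finset.mem_filter] at ht ⊢
      rcases ht with h | h | h
      · exact Or.inl h.1
      · exact Or.inr (h ▸ hj)
      · exact Or.inr h.1
    · rw [cnt_insert hjB₁, hA₁, hB₁, hcnt₁, hcnt₁]
      have h1 := hv.ballot (min c j)
      split_ifs with hc
      · rw [min_eq_right hc.le] at h1 ⊢
        omega
      · omega
  have hv₁' : Valid (insert j A₁) B₁ := by
    refine ⟨?_, fun t ht => hv₁.pos t ?_, fun c => ?_⟩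
    · rw [Finset.disjoint_insert_left]
      exact ⟨hjB₁, Finset.disjoint_filter_filter hv.disj⟩
    · rwa [Finset.insert_union, ← Finset.union_insert] at ht
    · have := hv₁.ballot c
      rw [cnt_insert hjB₁] at this
      rw [cnt_insert hjA₁]
      omega
  have hlt : ∀ p, (p = j ∨ p ∈ A₁ ∨ p ∈ B₁) → ∀ x ∈ A₂ ∪ B₂, p < x := by
    intro p hp x hx
    simp only [hA₁, hB₁, hA₂, hB₂, Finset.mem_union, Finset.mem_filter] at hp hx
    omega
  have e1 := rsTableau_of_split hv₁ hv₂ (fun p hp => hlt p (by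
    simp only [Finset.mem_union, Finset.mem_insert] at hp; tauto))
  have e2 := rsTableau_of_split hv₁' hv₂ (fun p hp => hlt p (by
    simp only [Finset.mem_union, Finset.mem_insert] at hp; tauto))
  have hsA₁ : (insert j A₁).sort = A₁.sort ++ [j] :=
    sort_insert_of_forall_lt fun a ha => (Finset.mem_filter.1 ha).2
  have hsB₁ : (insert j B₁).sort = B₁.sort ++ [j] :=
    sort_insert_of_forall_lt fun a ha => (Finset.mem_filter.1 ha).2
  have hA : A₁ ∪ A₂ = A := by
    ext t
    simp only [hA₁, hA₂, Finset.mem_union, Finset.mem_filter]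
    have : t ∈ A → t ≠ j := fun h he => hjA (he ▸ h)
    constructor
    · tauto
    · intro h
      have := this h
      rcases Nat.lt_or_gt_of_ne this with h1 | h1
      · exact Or.inl ⟨h, h1⟩
      · exact Or.inr ⟨h, h1⟩
  have hB : B₁ ∪ B₂ = B.erase j := by
    ext t
    simp only [hB₁, hB₂, Finset.mem_union, Finset.mem_filter, Finset.mem_erase]
    constructor
    · rintro (h | h)
      · exact ⟨by omega, h.1⟩
      · exact ⟨by omega, h.1⟩
    · rintro ⟨h, h'⟩
      rcases Nat.lt_or_gt_of_ne h with h1 | h1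
      · exact Or.inl ⟨h', h1⟩
      · exact Or.inr ⟨h', h1⟩
  rw [hsB₁, List.reverse_append, List.reverse_singleton, Finset.insert_union, hA, hB,
    Finset.insert_erase hj] at e1
  rw [hsA₁, List.reverse_append, List.reverse_singleton, Finset.insert_union, hA, hB] at e2
  refine DufloLE.of_weakLE hv.isTableau hvm.isTableau e1 e2 ?_
  have hn := ((flatten_rsTableau_perm _).nodup_iff.1 (e1 ▸ hv.nodup_flatten))
  refine WeakLE.append_left ?_ hn
  exact weakLE_move (fun x hx => by
    rw [List.mem_reverse, Finset.mem_sort] at hx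
    exact (Finset.mem_filter.1 hx).2) (List.nodup_append.1 hn).2.1

/-! ### The order by balanced intervals -/

/-- The entries of a two-column tableau in `[a, b)`, read as opening (first column) and closing
(second column) brackets, form a balanced sequence. -/
def Bal (A B : Finset ℕ) (a b : ℕ) : Prop :=
  (∀ c, a ≤ c → c ≤ b → cnt B c + cnt A a ≤ cnt A c + cnt B a) ∧
    cnt A b + cnt B a = cnt B b + cnt A a

/-- The order on two-column tableaux with the same entries in terms of balanced intervals. -/
structure BalLE (A B A' B' : Finset ℕ) : Prop where
  union : A ∪ B = A' ∪ B'
  bal : ∀ a ∈ A ∪ B, ∀ b ∈ A ∪ B, a < b → Bal A' B' a (b + 1) → Bal A B a (b + 1)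

theorem Bal.maxLE {A B : Finset ℕ} {a b : ℕ} (hab : a ≤ b) (h : Bal A B a b) :
    MaxLE A B a b (cnt A b - cnt A a) := fun c hac hcb => by
  have := h.1 c hac hcb
  have := cnt_mono A hab
  omega

/-- The ends `c = a` and `c = b` bound the numbers of opening and of closing entries by `k`. If `2k`
is at most their sum, both equal `k`, and the other values of `c` give the ballot condition. With
`Bal.maxLE`: balanced means that the projection has the shortest possible first column. -/
theorem MaxLE.bal {A B : Finset ℕ} {a b k : ℕ} (hab : a ≤ b) (h : MaxLE A B a b k)
    (hk : 2 * k + cnt A a + cnt B a ≤ cnt A b + cnt B b) : Bal A B a b := by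
  have h1 := h a le_rfl hab
  have h2 := h b hab le_rfl
  exact ⟨fun c hac hcb => by have := h c hac hcb; omega, by omega⟩

theorem cnt_add_cnt_eq {A B A' B' : Finset ℕ} (hv : Valid A B) (hv' : Valid A' B')
    (hu : A ∪ B = A' ∪ B') (c : ℕ) : cnt A c + cnt B c = cnt A' c + cnt B' c := by
  rw [← cnt_union hv.disj, hu, cnt_union hv'.disj]

theorem Bal.of_maxLE {A B A' B' : Finset ℕ} (hv : Valid A B) (hv' : Valid A' B')
    (hu : A ∪ B = A' ∪ B') {a b : ℕ} (hab : a ≤ b)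
    (h : ∀ k, MaxLE A' B' a b k → MaxLE A B a b k) (hb : Bal A' B' a b) : Bal A B a b := by
  refine (h _ (hb.maxLE hab)).bal hab ?_
  have h1 := hb.2
  have h2 := cnt_add_cnt_eq hv hv' hu a
  have h3 := cnt_add_cnt_eq hv hv' hu b
  have := cnt_mono A' hab
  omega

/-- Every entry of the second column has a matching entry in the first column. -/
theorem Valid.exists_partner {A B : Finset ℕ} (hv : Valid A B) {j : ℕ} (hj : j ∈ B) :
    ∃ i ∈ A, i < j ∧ Bal A B i (j + 1) := by
  have hjA : j ∉ A := fun h => hv.notMem_right h hj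
  have hA : cnt A (j + 1) = cnt A j := by rw [cnt_succ, if_neg hjA, add_zero]
  have hB : cnt B (j + 1) = cnt B j + 1 := by rw [cnt_succ, if_pos hj]
  -- `P i` says that `[i, j]` has at least as many opening as closing entries. The greatest such `i
  -- ≤ j` is the bracket matching `j`.
  let P : ℕ → Prop := fun i => cnt A i + cnt B (j + 1) ≤ cnt A (j + 1) + cnt B i
  have hP0 : P 0 := by simpa [P] using hv.ballot (j + 1)
  have hspec : P (Nat.findGreatest P j) := Nat.findGreatest_spec (Nat.zero_le j) hP0
  have hle : Nat.findGreatest P j ≤ j := Nat.findGreatest_le j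
  have hgr : ∀ c, Nat.findGreatest P j < c → c ≤ j → ¬ P c := fun c h1 h2 =>
    Nat.findGreatest_is_greatest h1 h2
  generalize Nat.findGreatest P j = i at hspec hle hgr
  simp only [P] at hspec hgr
  have hij : i < j := by
    rcases hle.lt_or_eq with h | rfl
    · exact h
    · omega
  have h1 := hgr (i + 1) (by omega) (by omega)
  have h2 := cnt_succ A i
  have h3 := cnt_succ B i
  have hiA : i ∈ A := by
    by_contra h
    rw [if_neg h] at h2
    omega
  rw [if_pos hiA] at h2
  rw [if_neg (hv.notMem_right hiA)] at h3
  refine ⟨i, hiA, hij, fun c hic hcj => ?_, by omega⟩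
  by_cases hc : c = i
  · subst hc; omega
  · by_cases hc' : c = j + 1
    · subst hc'; omega
    · have := hgr c (by omega) (by omega)
      omega

/-- The interval from the partner of `j` to `j` is balanced above, hence below, and a balanced
interval ends with a closing bracket. -/
theorem BalLE.right_subset {A B A' B' : Finset ℕ} (h : BalLE A B A' B') (hv' : Valid A' B') :
    B' ⊆ B := by
  intro j hj
  obtain ⟨i, hi, hij, hb⟩ := hv'.exists_partner hj
  have hjU : j ∈ A ∪ B := h.union ▸ Finset.mem_union_right _ hj
  have hb' := h.bal i (h.union ▸ Finset.mem_union_left _ hi) j hjU hij hb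
  have h1 := hb'.1 j hij.le (Nat.le_succ j)
  have h2 := hb'.2
  rcases Finset.mem_union.1 hjU with hA | hB
  · have h3 := cnt_succ A j
    have h4 := cnt_mono B (Nat.le_succ j)
    rw [if_pos hA] at h3
    have h5 := cnt_succ B j
    by_cases hB : j ∈ B
    · exact hB
    · rw [if_neg hB] at h5
      omega
  · exact hB

/-- In an interval balanced for both tableaux half of the entries close in each, so the inclusion
`B' ⊆ B` is an equality there. -/
theorem BalLE.mem_of_bal {A B A' B' : Finset ℕ} (h : BalLE A B A' B') (hv : Valid A B)
    (hv' : Valid A' B') {a b t : ℕ} (ha : a ∈ A ∪ B) (hb : b ∈ A ∪ B) (hab : a < b)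
    (hbal : Bal A' B' a (b + 1)) (hat : a ≤ t) (htb : t ≤ b) (ht : t ∈ B) : t ∈ B' := by
  have h0 := h.bal a ha b hb hab hbal
  have hs : B'.filter (fun t => a ≤ t ∧ t < b + 1) ⊆ B.filter (fun t => a ≤ t ∧ t < b + 1) :=
    Finset.filter_subset_filter _ (h.right_subset hv')
  have h1 := cnt_filter_Ico B (show a ≤ b + 1 by omega)
  have h2 := cnt_filter_Ico B' (show a ≤ b + 1 by omega)
  have h3 := cnt_add_cnt_eq hv hv' h.union a
  have h4 := cnt_add_cnt_eq hv hv' h.union (b + 1)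
  have h5 := h0.2
  have h6 := hbal.2
  have he := Finset.eq_of_subset_of_card_le hs (by omega)
  have : t ∈ B'.filter (fun t => a ≤ t ∧ t < b + 1) := by
    rw [he, Finset.mem_filter]
    exact ⟨ht, hat, by omega⟩
  exact (Finset.mem_filter.1 this).1

/-- If `A`, `B` is less than `A'`, `B'`, then some entry of `B` can be moved to the first column such
that the result is still at most `A'`, `B'`. -/
theorem BalLE.exists_move {A B A' B' : Finset ℕ} (h : BalLE A B A' B') (hv : Valid A B)
    (hv' : Valid A' B') (hne : B ≠ B') : ∃ j ∈ B, Valid (insert j A) (B.erase j) ∧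
      DufloLE (cols A B) (cols (insert j A) (B.erase j)) ∧
      BalLE (insert j A) (B.erase j) A' B' := by
  have hsub := h.right_subset hv'
  have hnon : (B \ B').Nonempty := by
    rw [Finset.sdiff_nonempty]
    exact fun hs => hne (Finset.Subset.antisymm hs hsub)
  have hmem := Finset.max'_mem _ hnon
  have hmax : ∀ t ∈ B, t ∉ B' → t ≤ (B \ B').max' hnon := fun t h1 h2 =>
    Finset.le_max' _ t (Finset.mem_sdiff.2 ⟨h1, h2⟩)
  generalize (B \ B').max' hnon = j at hmem hmax
  obtain ⟨hj, hj'⟩ := Finset.mem_sdiff.1 hmem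
  have hjA : j ∉ A := fun h => hv.notMem_right h hj
  -- The entries of `A`, `B` beyond `j` form a tableau. A closing `d > j` also closes in `B'` by
  -- maximality of `j`. Its partner `i` there lies beyond `j`, since otherwise `j` would lie in a
  -- common balanced interval. So `[i, d]` is balanced for `A`, `B` and can be cut off.
  have key : ∀ c, j < c → cnt B c + cnt A j ≤ cnt A c + cnt B j + 1 := by
    intro c
    induction c using Nat.strong_induction_on with
    | _ c ih =>
      intro hjc
      obtain ⟨d, rfl⟩ : ∃ d, c = d + 1 := ⟨c - 1, by omega⟩
      have h1 := cnt_succ A d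
      have h2 := cnt_succ B d
      by_cases hdj : d = j
      · subst hdj
        split_ifs at h1 h2
        omega
      · by_cases hdB : d ∈ B
        · have hdB' : d ∈ B' := by
            by_contra hn
            have := hmax d hdB hn
            omega
          obtain ⟨i, hi, hid, hb⟩ := hv'.exists_partner hdB'
          have hiU : i ∈ A ∪ B := h.union ▸ Finset.mem_union_left _ hi
          have hdU : d ∈ A ∪ B := Finset.mem_union_right _ hdB
          have hji : j < i := by
            by_contra hn
            exact hj' (h.mem_of_bal hv hv' hiU hdU hid hb (by omega) (by omega) hj)
          have h3 := ih i (by omega) hji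
          have h4 := (h.bal i hiU d hdU hid hb).2
          omega
        · rw [if_neg hdB] at h2
          have := ih d (by omega) (by omega)
          omega
  obtain ⟨h1, h2⟩ := dufloLE_move hv hj key
  have hu : insert j A ∪ B.erase j = A ∪ B := by
    rw [Finset.insert_union, ← Finset.union_insert, Finset.insert_erase hj]
  refine ⟨j, hj, h1, h2, hu.trans h.union, fun a ha b hb hab hbal => ?_⟩
  rw [hu] at ha hb
  have h3 := h.bal a ha b hb hab hbal
  -- Intervals balanced for `A'`, `B'` avoid `j`, so moving `j` does not affect them.
  have hj2 : j < a ∨ b < j := by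
    by_contra hn
    exact hj' (h.mem_of_bal hv hv' ha hb hab hbal (by omega) (by omega) hj)
  have hA := fun c => cnt_insert hjA c
  have hB := fun c => cnt_erase hj c
  constructor
  · intro c hac hcb
    have h4 := h3.1 c hac hcb
    have := hA a
    have := hB a
    have := hA c
    have := hB c
    split_ifs at * <;> omega
  · have h4 := h3.2
    have := hA a
    have := hB a
    have := hA (b + 1)
    have := hB (b + 1)
    split_ifs at * <;> omega

theorem Valid.left_eq {A B A' B' : Finset ℕ} (hv : Valid A B) (hv' : Valid A' B')
    (hu : A ∪ B = A' ∪ B') (h : B = B') : A = A' := by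
  subst h
  rw [← Finset.union_sdiff_cancel_right hv.disj, hu, Finset.union_sdiff_cancel_right hv'.disj]

/-- Each move of `BalLE.exists_move` takes one entry out of `B`, so finitely many moves reach `B'`.
-/
theorem BalLE.dufloLE {A B A' B' : Finset ℕ} (h : BalLE A B A' B') (hv : Valid A B)
    (hv' : Valid A' B') : DufloLE (cols A B) (cols A' B') := by
  induction hn : B.card generalizing A B with
  | zero =>
    have hB : B = ∅ := Finset.card_eq_zero.1 hn
    have hB' : B' = B := by
      have := h.right_subset hv'
      rw [hB] at this ⊢
      exact Finset.subset_empty.1 this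
    have hA' := hv.left_eq hv' h.union hB'.symm
    rw [hB', ← hA']
    exact DufloLE.refl hv.isTableau
  | succ n ih =>
    by_cases hB : B = B'
    · have hA' := hv.left_eq hv' h.union hB
      rw [← hB, ← hA']
      exact DufloLE.refl hv.isTableau
    · obtain ⟨j, hj, h1, h2, h3⟩ := h.exists_move hv hv' hB
      refine h2.trans (ih h3 h1 ?_)
      rw [Finset.card_erase_of_mem hj]
      omega

/-! ### Jeu de taquin for two-column tableaux -/

theorem slide_nil (above below : List ℕ) : slide above below [] = consCol (above ++ below) [] := by
  rw [slide]

theorem cols_eq_of_pairwise {C D : List ℕ} (hC : C.Pairwise (· < ·)) (hD : D.Pairwise (· < ·)) :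
    cols C.toFinset D.toFinset = ofCols C D := by
  rw [cols, sort_toFinset_of_pairwise hC, sort_toFinset_of_pairwise hD]

theorem ofCols_of_ne_nil {C : List ℕ} (hC : C ≠ []) (D : List ℕ) :
    ofCols C D = C :: consCol D [] := by
  simp [ofCols, consCol, hC]

/-- The possible results of sliding a hole from the top of the first column: either the second column
does not change, or its entry `z` moves to the first column. -/
def SlideResult (A B : Finset ℕ) (S : List (List ℕ)) : Prop :=
  (S = cols A B ∧ ∀ c, cnt B c ≤ cnt A c) ∨
    ∃ z ∈ B, S = cols (insert z A) (B.erase z) ∧ cnt A z = cnt B z ∧ ∀ c ≤ z, cnt B c ≤ cnt A c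

/-- `z` enters the hole in its own row, so as many entries lie above the hole as above `z` in the
second column. This gives `cnt A z = cnt B z`: with the hole's entry gone, `z` is the first closing
bracket violating the ballot condition. -/
theorem slideResult_move {above below D₁ D₂ : List ℕ} {z : ℕ}
    (hC : (above ++ below).Pairwise (· < ·)) (hD : (D₁ ++ z :: D₂).Pairwise (· < ·))
    (hlen : above.length = D₁.length)
    (hrow : ∀ (i : ℕ) (h : i < above.length) (h' : i < D₁.length), above[i] < D₁[i])
    (hz : ∀ y ∈ below, z < y) :
    SlideResult (above ++ below).toFinset (D₁ ++ z :: D₂).toFinset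
      ((above ++ z :: below) :: consCol (D₁ ++ D₂) []) := by
  right
  have hD' := hD
  rw [List.pairwise_append, List.pairwise_cons] at hD
  have hC' := hC
  rw [List.pairwise_append] at hC
  have habove : ∀ y ∈ above, y < z := by
    intro y hy
    obtain ⟨i, hi, rfl⟩ := List.getElem_of_mem hy
    exact (hrow i hi (hlen ▸ hi)).trans (hD.2.2 _ (List.getElem_mem _) z (by simp))
  have h1 : (above ++ z :: below).Pairwise (· < ·) := by
    rw [List.pairwise_append, List.pairwise_cons]
    refine ⟨hC.1, ⟨hz, hC.2.1⟩, fun y hy t ht => ?_⟩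
    rcases List.mem_cons.1 ht with rfl | ht
    · exact habove y hy
    · exact hC.2.2 y hy t ht
  have h2 : (D₁ ++ D₂).Pairwise (· < ·) := by
    rw [List.pairwise_append]
    exact ⟨hD.1, hD.2.1.2, fun y hy t ht => hD.2.2 y hy t (by simp [ht])⟩
  have hcB : ∀ c ≤ z, cnt (D₁ ++ z :: D₂).toFinset c = D₁.countP (· < c) := by
    intro c hc
    rw [cnt_toFinset hD', List.countP_append, add_eq_left, List.countP_eq_zero]
    intro t ht
    rcases List.mem_cons.1 ht with rfl | ht
    · simpa using hc
    · have := hD.2.1.1 t ht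
      simp; omega
  have hcA : ∀ c ≤ z, cnt (above ++ below).toFinset c = above.countP (· < c) := by
    intro c hc
    rw [cnt_toFinset hC', List.countP_append, add_eq_left, List.countP_eq_zero]
    intro t ht
    have := hz t ht
    simp; omega
  refine ⟨z, by simp, ?_, ?_, fun c hc => ?_⟩
  · rw [← ofCols_of_ne_nil (by simp), ← cols_eq_of_pairwise h1 h2]
    congr 1
    · ext t
      simp only [List.mem_toFinset, List.mem_append, List.mem_cons, Finset.mem_insert]
      tauto
    · ext t
      simp only [List.mem_toFinset, List.mem_append, List.mem_cons, Finset.mem_erase]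
      constructor
      · rintro (h | h)
        · have := hD.2.2 t h z (by simp)
          exact ⟨by omega, Or.inl h⟩
        · have := hD.2.1.1 t h
          exact ⟨by omega, Or.inr (Or.inr h)⟩
      · tauto
  · rw [hcA z le_rfl, hcB z le_rfl, List.countP_eq_length.2 (by simpa using habove),
      List.countP_eq_length.2 (by
        intro t ht
        simpa using hD.2.2 t ht z (by simp)), hlen]
  · rw [hcA c hc, hcB c hc]
    exact countP_le_of_rows hlen.ge hrow c

theorem slideResult_stay {C D : List ℕ} (hC : C.Pairwise (· < ·)) (hD : D.Pairwise (· < ·))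
    (hlen : D.length ≤ C.length)
    (hrow : ∀ (i : ℕ) (h : i < C.length) (h' : i < D.length), C[i] < D[i]) :
    SlideResult C.toFinset D.toFinset (ofCols C D) :=
  Or.inl ⟨(cols_eq_of_pairwise hC hD).symm, fun c => by
    rw [cnt_toFinset hC, cnt_toFinset hD]
    exact countP_le_of_rows hlen hrow c⟩

/-- Invariant: the entries above the hole are less than their right neighbours in `D`. Moving up a
lower neighbour smaller than the right one extends it by a row. Once the hole is below the last row
of `D`, the second column stays as it is. -/
theorem slideResult_slide : ∀ {below above D : List ℕ}, (above ++ below).Pairwise (· < ·) →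
    D.Pairwise (· < ·) → D ≠ [] → (∀ t ∈ above ++ below, t ∉ D) →
    D.length ≤ above.length + below.length + 1 →
    (∀ (i : ℕ) (h : i < above.length) (h' : i < D.length), above[i] < D[i]) →
    SlideResult (above ++ below).toFinset D.toFinset (slide above below [D])
  | below, above, D, hC, hD, hne, hdis, hlen, hrow => by
    by_cases hr : above.length < D.length
    · have hsplit : D = D.take above.length ++ D[above.length] :: D.drop (above.length + 1) := by
        rw [← List.drop_eq_getElem_cons, List.take_append_drop]
      have hmove : (∀ y ∈ below, D[above.length] < y) →
          SlideResult (above ++ below).toFinset D.toFinset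
            ((above ++ D[above.length] :: below) ::
              consCol (D.take above.length ++ D.drop (above.length + 1)) []) := by
        intro hz
        have := slideResult_move (z := D[above.length]) hC (hsplit ▸ hD)
          (by rw [List.length_take]; omega)
          (fun i h h' => by
            rw [List.getElem_take]
            exact hrow i h (by omega)) hz
        rwa [← hsplit] at this
      match below, hC, hdis, hlen, hmove with
      | [], hC, hdis, hlen, hmove =>
        rw [slide, List.getElem?_eq_getElem hr]
        simp only [slide_nil]
        exact hmove (by simp)
      | y :: bl, hC, hdis, hlen, hmove =>
        rw [slide, List.getElem?_eq_getElem hr]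
        simp only [slide_nil]
        split_ifs with hy
        · have h1 := slideResult_slide (below := bl) (above := above ++ [y]) (D := D)
            (by simpa using hC) hD hne (by simpa using hdis)
            (by simp only [List.length_append, List.length_cons, List.length_nil] at hlen ⊢; omega)
            (fun i h h' => by
              by_cases hi : i < above.length
              · rw [List.getElem_append_left hi]
                exact hrow i hi h'
              · have : i = above.length := by
                  simp only [List.length_append, List.length_cons, List.length_nil] at h
                  omega
                subst this
                simpa using hy)
          simpa using h1
        · refine hmove fun t ht => ?_
          have h1 : D[above.length] < y := by
            have : D[above.length] ≠ y := fun he => hdis y (by simp) (he ▸ List.getElem_mem _)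
            omega
          rw [List.pairwise_append, List.pairwise_cons] at hC
          rcases List.mem_cons.1 ht with rfl | ht
          · exact h1
          · exact h1.trans (hC.2.1.1 t ht)
    · have hnone : D[above.length]? = none := List.getElem?_eq_none (by omega)
      have hane : above ≠ [] := by
        rintro rfl
        exact hne (List.eq_nil_of_length_eq_zero (by simpa using hr))
      have h1 : slide above below [D] = ofCols (above ++ below) D := by
        match below with
        | [] =>
          rw [slide, hnone]
          simp [ofCols, consCol, hne]
        | y :: bl =>
          rw [slide, hnone]
          simp [ofCols, consCol, hne]
      rw [h1]
      refine slideResult_stay hC hD (by rw [List.length_append]; omega) fun i h h' => ?_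
      rw [List.getElem_append_left (by omega)]
      exact hrow i (by omega) h'

theorem sort_eq_cons_of_min {A : Finset ℕ} {x : ℕ} (hx : x ∈ A) (hmin : ∀ t ∈ A, x ≤ t) :
    A.sort = x :: (A.erase x).sort := by
  refine sort_eq_of_pairwise ?_ fun y => ?_
  · rw [List.pairwise_cons]
    refine ⟨fun t ht => ?_, pairwise_sort _⟩
    rw [Finset.mem_sort, Finset.mem_erase] at ht
    have := hmin t ht.2
    omega
  · rw [List.mem_cons, Finset.mem_sort, Finset.mem_erase]
    by_cases h : y = x
    · simp [h, hx]
    · simp [h]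

theorem sort_eq_append_of_max {A : Finset ℕ} {x : ℕ} (hx : x ∈ A) (hmax : ∀ t ∈ A, t ≤ x) :
    A.sort = (A.erase x).sort ++ [x] := by
  conv_lhs => rw [← Finset.insert_erase hx]
  refine sort_insert_of_forall_lt fun t ht => ?_
  have := hmax t (Finset.mem_of_mem_erase ht)
  have := Finset.ne_of_mem_erase ht
  omega

theorem slideResult_jdtRemove {A B : Finset ℕ} {x : ℕ} (hv : Valid A B) (hxA : x ∈ A)
    (hmin : ∀ t ∈ A, x ≤ t) : SlideResult (A.erase x) B (jdtRemove (cols A B) x) := by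
  have hs := sort_eq_cons_of_min hxA hmin
  rcases hv.cases with ⟨h1, _, _⟩ | ⟨_, rfl, h3⟩ | ⟨_, h2, h3⟩
  · simp [h1] at hxA
  · rw [h3, hs]
    simp only [jdtRemove, List.mem_cons, true_or, if_true, List.idxOf_cons_self, List.take_zero,
      zero_add, List.drop_one, List.tail_cons, slide_nil]
    refine Or.inl ⟨?_, by simp⟩
    simp [cols, ofCols, consCol]
  · have h4 : jdtRemove (cols A B) x = slide [] (A.erase x).sort [B.sort] := by
      rw [h3, hs]
      simp [jdtRemove]
    have hcard : B.sort.length ≤ (A.erase x).sort.length + 1 := by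
      rw [Finset.length_sort, Finset.length_sort, Finset.card_erase_add_one hxA]
      exact hv.card_le
    have h5 := slideResult_slide (below := (A.erase x).sort) (above := []) (D := B.sort)
      (by simpa using pairwise_sort _) (pairwise_sort B) (sort_ne_nil h2)
      (by
        intro t ht
        rw [List.nil_append, Finset.mem_sort] at ht
        rw [Finset.mem_sort]
        exact hv.notMem_right (Finset.mem_of_mem_erase ht))
      (by simpa using hcard) (by simp)
    rw [h4]
    simpa only [List.nil_append, Finset.sort_toFinset] using h5

theorem Valid.min_mem {A B : Finset ℕ} {x : ℕ} (hv : Valid A B) (hx : x ∈ A ∪ B)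
    (hmin : ∀ t ∈ A ∪ B, x ≤ t) : x ∈ A := by
  by_contra hxA
  have hxB : x ∈ B := by simpa [hxA] using hx
  have h1 := hv.ballot (x + 1)
  rw [cnt_succ, cnt_succ, if_pos hxB, if_neg hxA,
    cnt_eq_zero fun t ht => hmin t (Finset.mem_union_left _ ht)] at h1
  omega

/-- Removal of the smallest entry. -/
theorem jdtRemove_min {A B : Finset ℕ} {x : ℕ} (hv : Valid A B) (hx : x ∈ A ∪ B)
    (hmin : ∀ t ∈ A ∪ B, x ≤ t) : ∃ A' B', jdtRemove (cols A B) x = cols A' B' ∧ Valid A' B' ∧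
      A' ∪ B' = (A ∪ B).erase x ∧
      ∀ a b k, x < a → a ≤ b → (MaxLE A' B' a b k ↔ MaxLE A B a b k) := by
  have hxA := hv.min_mem hx hmin
  have hxB := hv.notMem_right hxA
  have hA := fun c => cnt_erase hxA c
  have hdis : Disjoint (A.erase x) B := hv.disj.mono_left (Finset.erase_subset _ _)
  -- After deletion of the opening bracket `x`, either the rest is still a ballot word, or its first
  -- unmatched closing bracket `z` becomes opening.
  rcases slideResult_jdtRemove hv hxA fun t ht => hmin t (Finset.mem_union_left _ ht) with
    ⟨h1, h2⟩ | ⟨z, hz, h1, h2, h3⟩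
  · refine ⟨_, _, h1, ⟨hdis, fun t ht => hv.pos t ?_, h2⟩, ?_, fun a b k hxa hab => ?_⟩
    · exact Finset.union_subset_union (Finset.erase_subset _ _) le_rfl ht
    · rw [Finset.erase_union_distrib, Finset.erase_eq_of_notMem hxB]
    · refine forall_congr' fun c => forall_congr' fun hac => forall_congr' fun hcb => ?_
      have h4 := hA c
      have h5 := hA b
      rw [if_pos (by omega)] at h4 h5
      omega
  · have hxz : x < z := by
      have := hmin z (Finset.mem_union_right _ hz)
      have : z ≠ x := fun he => hxB (he ▸ hz)
      omega
    have hzA : z ∉ A := fun h => hv.notMem_right h hz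
    have hzA' : z ∉ A.erase x := fun h => hzA (Finset.mem_of_mem_erase h)
    have hA' := fun c => cnt_insert hzA' c
    have hB' := fun c => cnt_erase hz c
    have hv' : Valid (insert z (A.erase x)) (B.erase z) := by
      refine ⟨?_, fun t ht => hv.pos t ?_, fun c => ?_⟩
      · rw [Finset.disjoint_insert_left]
        exact ⟨Finset.notMem_erase _ _, hdis.mono_right (Finset.erase_subset _ _)⟩
      · rw [Finset.insert_union, ← Finset.union_insert, Finset.insert_erase hz] at ht
        exact Finset.union_subset_union (Finset.erase_subset _ _) le_rfl ht
      · have h4 := hA c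
        have h5 := hA' c
        have h6 := hB' c
        have h7 := hv.ballot c
        by_cases hc : c ≤ z
        · have := h3 c hc
          split_ifs at * <;> omega
        · split_ifs at * <;> omega
    refine ⟨_, _, h1, hv', ?_, fun a b k hxa hab => ?_⟩
    · rw [Finset.insert_union, ← Finset.union_insert, Finset.insert_erase hz,
        Finset.erase_union_distrib, Finset.erase_eq_of_notMem hxB]
    · have hAz := cnt_succ A z
      have hBz := cnt_succ B z
      rw [if_neg hzA] at hAz
      rw [if_pos hz] at hBz
      have e1 := hA z
      have e2 := hA b
      have e3 := hA' b
      have e4 := hB' a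
      have e5 := hB' z
      have e6 := hA' z
      rw [if_pos (by omega)] at e1 e2
      rw [if_neg (lt_irrefl z)] at e5 e6
      constructor
      · intro h c hac hcb
        have f1 := hA c
        have f2 := hA' c
        have f3 := hB' c
        rw [if_pos (by omega)] at f1
        by_cases hz' : a ≤ z ∧ z < b
        -- With `z` in the interval both maxima are `cnt A b - cnt B a`: the excess of closing over
        -- opening entries is never positive, and it vanishes at `z` for the new pair and at `z + 1`
        -- for the old one.
        · have f4 := h z hz'.1 hz'.2.le
          have f5 := hv.ballot c
          split_ifs at * <;> omega
        · have f4 := h c hac hcb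
          split_ifs at * <;> omega
      · intro h c hac hcb
        have f1 := hA c
        have f2 := hA' c
        have f3 := hB' c
        rw [if_pos (by omega)] at f1
        by_cases hz' : a ≤ z ∧ z < b
        · have f4 := h (z + 1) (by omega) hz'.2
          have f5 := hv'.ballot c
          split_ifs at * <;> omega
        · have f4 := h c hac hcb
          split_ifs at * <;> omega

theorem jdtRemove_singleton_max {B : Finset ℕ} {x : ℕ} (hx : x ∈ B) (hmax : ∀ t ∈ B, t ≤ x)
    (R : List (List ℕ)) :
    jdtRemove (B.sort :: R) x = slide (B.erase x).sort [] R := by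
  have hs := sort_eq_append_of_max hx hmax
  have hn : x ∉ (B.erase x).sort := by simp
  have hi : ((B.erase x).sort ++ [x]).idxOf x = (B.erase x).sort.length := by
    rw [List.idxOf_append, if_neg hn]
    simp
  rw [jdtRemove, if_pos ((Finset.mem_sort _).2 hx), hs, hi, List.take_left,
    List.drop_eq_nil_of_le (by simp)]

theorem cnt_erase_of_le {A : Finset ℕ} {x c : ℕ} (h : c ≤ x) : cnt (A.erase x) c = cnt A c :=
  cnt_congr fun t ht => by
    have : t ≠ x := by omega
    simp [this]

/-- Removal of the greatest entry. -/
theorem jdtRemove_max {A B : Finset ℕ} {x : ℕ} (hv : Valid A B) (hx : x ∈ A ∪ B)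
    (hmax : ∀ t ∈ A ∪ B, t ≤ x) : jdtRemove (cols A B) x = cols (A.erase x) (B.erase x) ∧
      Valid (A.erase x) (B.erase x) := by
  have hcA : ∀ c, cnt (A.erase x) c = cnt A (min c x) := fun c => by
    by_cases hc : c ≤ x
    · rw [min_eq_left hc, cnt_erase_of_le hc]
    · rw [min_eq_right (by omega), ← cnt_erase_of_le (A := A) (le_refl x)]
      refine (cnt_eq_of_gap (c := x) (d := c) (by omega) fun t ht hxt => ?_).symm
      have := hmax t (Finset.mem_union_left _ (Finset.mem_of_mem_erase ht))
      have := Finset.ne_of_mem_erase ht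
      omega
  have hcB : ∀ c, cnt (B.erase x) c = cnt B (min c x) := fun c => by
    by_cases hc : c ≤ x
    · rw [min_eq_left hc, cnt_erase_of_le hc]
    · rw [min_eq_right (by omega), ← cnt_erase_of_le (A := B) (le_refl x)]
      refine (cnt_eq_of_gap (c := x) (d := c) (by omega) fun t ht hxt => ?_).symm
      have := hmax t (Finset.mem_union_right _ (Finset.mem_of_mem_erase ht))
      have := Finset.ne_of_mem_erase ht
      omega
  have hv' : Valid (A.erase x) (B.erase x) := by
    refine ⟨?_, fun t ht => hv.pos t ?_, fun c => ?_⟩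
    · exact hv.disj.mono (Finset.erase_subset _ _) (Finset.erase_subset _ _)
    · exact Finset.union_subset_union (Finset.erase_subset _ _) (Finset.erase_subset _ _) ht
    · rw [hcA, hcB]
      exact hv.ballot _
  refine ⟨?_, hv'⟩
  rcases Finset.mem_union.1 hx with hxA | hxB
  · have hxB := hv.notMem_right hxA
    have hmA : ∀ t ∈ A, t ≤ x := fun t ht => hmax t (Finset.mem_union_left _ ht)
    rw [Finset.erase_eq_of_notMem hxB] at hv' ⊢
    rcases hv.cases with ⟨h1, _, _⟩ | ⟨_, rfl, h3⟩ | ⟨_, h2, h3⟩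
    · simp [h1] at hxA
    · rw [h3, jdtRemove_singleton_max hxA hmA, slide_nil]
      simp [cols, ofCols, consCol]
    · rw [h3, jdtRemove_singleton_max hxA hmA]
      -- The pair without `x` is still valid, so the hole at the bottom of the first column has no
      -- right neighbour.
      have hnone : B.sort[(A.erase x).sort.length]? = none := by
        apply List.getElem?_eq_none
        rw [Finset.length_sort, Finset.length_sort]
        exact hv'.card_le
      rw [slide, hnone]
      simp [cols, ofCols, consCol, sort_ne_nil h2]
  · have hxA : x ∉ A := fun h => hv.notMem_right h hxB
    have hmB : ∀ t ∈ B, t ≤ x := fun t ht => hmax t (Finset.mem_union_right _ ht)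
    rw [Finset.erase_eq_of_notMem hxA]
    have hA : A ≠ ∅ := fun h => by
      have := hv.right_eq_empty h
      simp [this] at hxB
    rw [cols_of_ne hA (Finset.ne_empty_of_mem hxB), jdtRemove,
      if_neg (fun h => hxA ((Finset.mem_sort _).1 h)), jdtRemove_singleton_max hxB hmB, slide_nil,
      List.append_nil, cols, ofCols_of_ne_nil (sort_ne_nil hA)]

theorem foldl_jdtRemove_small : ∀ {l : List ℕ} {A B : Finset ℕ}, l.Pairwise (· < ·) → Valid A B →
    (∀ t ∈ l, t ∈ A ∪ B) → (∀ t ∈ A ∪ B, t ∉ l → ∀ s ∈ l, s < t) →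
    ∃ A' B', l.foldl jdtRemove (cols A B) = cols A' B' ∧ Valid A' B' ∧
      A' ∪ B' = (A ∪ B) \ l.toFinset ∧
      ∀ a b k, (∀ s ∈ l, s < a) → a ≤ b → (MaxLE A' B' a b k ↔ MaxLE A B a b k)
  | [], A, B, _, hv, _, _ => ⟨A, B, rfl, hv, by simp, fun _ _ _ _ _ => Iff.rfl⟩
  | x :: l, A, B, hl, hv, hmem, hlt => by
    rw [List.pairwise_cons] at hl
    obtain ⟨A₁, B₁, h1, h2, h3, h4⟩ := jdtRemove_min hv (hmem x (by simp)) fun t ht => by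
      by_cases h : t ∈ x :: l
      · rcases List.mem_cons.1 h with rfl | h
        · exact le_rfl
        · exact (hl.1 t h).le
      · exact (hlt t ht h x (by simp)).le
    obtain ⟨A', B', h5, h6, h7, h8⟩ := foldl_jdtRemove_small hl.2 h2
      (fun t ht => by
        have := hl.1 t ht
        rw [h3, Finset.mem_erase]
        exact ⟨by omega, hmem t (by simp [ht])⟩)
      (fun t ht htl s hs => by
        rw [h3, Finset.mem_erase] at ht
        exact hlt t ht.2 (by simp [ht.1, htl]) s (by simp [hs]))
    refine ⟨A', B', by rw [List.foldl_cons, h1, h5], h6, ?_, fun a b k ha hab => ?_⟩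
    · rw [h7, h3]
      ext t
      simp only [Finset.mem_sdiff, Finset.mem_erase, List.toFinset_cons, Finset.mem_insert]
      tauto
    · rw [h8 a b k (fun s hs => ha s (by simp [hs])) hab, h4 a b k (ha x (by simp)) hab]

theorem foldl_jdtRemove_large : ∀ {l : List ℕ} {A B : Finset ℕ}, l.Pairwise (· > ·) → Valid A B →
    (∀ t ∈ l, t ∈ A ∪ B) → (∀ t ∈ A ∪ B, t ∉ l → ∀ s ∈ l, t < s) →
    l.foldl jdtRemove (cols A B) = cols (A \ l.toFinset) (B \ l.toFinset) ∧
      Valid (A \ l.toFinset) (B \ l.toFinset)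
  | [], A, B, _, hv, _, _ => by simpa using hv
  | x :: l, A, B, hl, hv, hmem, hlt => by
    rw [List.pairwise_cons] at hl
    obtain ⟨h1, h2⟩ := jdtRemove_max hv (hmem x (by simp)) fun t ht => by
      by_cases h : t ∈ x :: l
      · rcases List.mem_cons.1 h with rfl | h
        · exact le_rfl
        · exact (hl.1 t h).le
      · exact (hlt t ht h x (by simp)).le
    have h3 : A.erase x ∪ B.erase x = (A ∪ B).erase x := (Finset.erase_union_distrib _ _ _).symm
    have h4 := foldl_jdtRemove_large hl.2 h2
      (fun t ht => by
        have := hl.1 t ht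
        rw [h3, Finset.mem_erase]
        exact ⟨by omega, hmem t (by simp [ht])⟩)
      (fun t ht htl s hs => by
        rw [h3, Finset.mem_erase] at ht
        exact hlt t ht.2 (by simp [ht.1, htl]) s (by simp [hs]))
    have h5 : ∀ C : Finset ℕ, C.erase x \ l.toFinset = C \ (x :: l).toFinset := fun C => by
      ext t
      simp only [Finset.mem_sdiff, Finset.mem_erase, List.toFinset_cons, Finset.mem_insert]
      tauto
    rw [h5, h5] at h4
    rwa [List.foldl_cons, h1]

/-- The projection of a two-column tableau. -/
theorem Valid.proj {A B : Finset ℕ} (hv : Valid A B) {a b : ℕ} (hab : a ≤ b + 1) :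
    ∃ A' B', proj a b (cols A B) = cols A' B' ∧ Valid A' B' ∧
      A' ∪ B' = (A ∪ B).filter (fun t => a ≤ t ∧ t ≤ b) ∧
      ∀ k, A'.card ≤ k ↔ MaxLE A B a (b + 1) k := by
  unfold YoungTab.proj
  simp only [List.foldl_append]
  set small := ((cols A B).flatten.filter (· < a)).insertionSort (· ≤ ·) with hsmall
  set large := ((cols A B).flatten.filter (b < ·)).insertionSort (· ≥ ·) with hlarge
  have hms : ∀ t, t ∈ small ↔ t ∈ A ∪ B ∧ t < a := fun t => by
    rw [hsmall, List.mem_insertionSort, List.mem_filter, mem_flatten_cols]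
    simp
  have hml : ∀ t, t ∈ large ↔ t ∈ A ∪ B ∧ b < t := fun t => by
    rw [hlarge, List.mem_insertionSort, List.mem_filter, mem_flatten_cols]
    simp
  have hps : small.Pairwise (· < ·) := by
    have h1 : small.Pairwise (· ≤ ·) := List.pairwise_insertionSort _ _
    have h2 : small.Nodup :=
      (List.perm_insertionSort _ _).nodup_iff.2 (hv.nodup_flatten.filter _)
    exact h1.imp₂ (fun _ _ h h' => lt_of_le_of_ne h h') h2
  have hpl : large.Pairwise (· > ·) := by
    have h1 : large.Pairwise (· ≥ ·) := List.pairwise_insertionSort _ _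
    have h2 : large.Nodup :=
      (List.perm_insertionSort _ _).nodup_iff.2 (hv.nodup_flatten.filter _)
    exact h1.imp₂ (fun _ _ h h' => lt_of_le_of_ne h h'.symm) h2
  obtain ⟨A₁, B₁, h1, h2, h3, h4⟩ := foldl_jdtRemove_small hps hv (fun t ht => ((hms t).1 ht).1)
    (fun t ht hts s hs => by
      have := ((hms s).1 hs).2
      have : ¬ t < a := fun h => hts ((hms t).2 ⟨ht, h⟩)
      omega)
  have hU : ∀ t, t ∈ A₁ ∪ B₁ ↔ t ∈ A ∪ B ∧ a ≤ t := fun t => by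
    rw [h3, Finset.mem_sdiff, List.mem_toFinset, hms]
    constructor
    · rintro ⟨h, h'⟩
      exact ⟨h, by by_contra hn; exact h' ⟨h, by omega⟩⟩
    · rintro ⟨h, h'⟩
      exact ⟨h, fun hn => by omega⟩
  obtain ⟨h5, h6⟩ := foldl_jdtRemove_large hpl h2
    (fun t ht => (hU t).2 ⟨((hml t).1 ht).1, by have := ((hml t).1 ht).2; omega⟩)
    (fun t ht hts s hs => by
      have := ((hml s).1 hs).2
      have : ¬ b < t := fun h => hts ((hml t).2 ⟨((hU t).1 ht).1, h⟩)
      omega)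
  have hU' : (A₁ \ large.toFinset) ∪ (B₁ \ large.toFinset) =
      (A ∪ B).filter (fun t => a ≤ t ∧ t ≤ b) := by
    rw [← Finset.union_sdiff_distrib]
    ext t
    rw [Finset.mem_sdiff, hU, List.mem_toFinset, hml, Finset.mem_filter]
    constructor
    · rintro ⟨⟨h, h'⟩, h''⟩
      exact ⟨h, h', by by_contra hn; exact h'' ⟨h, by omega⟩⟩
    · rintro ⟨h, h', h''⟩
      exact ⟨⟨h, h'⟩, fun hn => by omega⟩
  refine ⟨_, _, by rw [h1, h5], h6, hU', fun k => ?_⟩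
  rw [← h4 a (b + 1) k (fun s hs => ((hms s).1 hs).2) hab]
  have hc : ∀ C : Finset ℕ, ∀ c ≤ b + 1, cnt C c = cnt (C \ large.toFinset) c := fun C c hc =>
    cnt_congr fun t ht => by
      rw [Finset.mem_sdiff, List.mem_toFinset, hml]
      constructor
      · exact fun h => ⟨h, fun hn => by omega⟩
      · exact fun h => h.1
  have hmem : ∀ t, (t ∈ A₁ \ large.toFinset ∨ t ∈ B₁ \ large.toFinset) → a ≤ t ∧ t ≤ b :=
    fun t ht => by
      rw [← Finset.mem_union, hU', Finset.mem_filter] at ht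
      exact ht.2
  have hA1 : cnt A₁ (b + 1) = (A₁ \ large.toFinset).card := by
    rw [hc A₁ (b + 1) le_rfl]
    exact cnt_eq_card fun t ht => by have := hmem t (Or.inl ht); omega
  have hA2 : cnt A₁ a = 0 := by
    rw [hc A₁ a hab]
    exact cnt_eq_zero fun t ht => (hmem t (Or.inl ht)).1
  have hB2 : cnt B₁ a = 0 := by
    rw [hc B₁ a hab]
    exact cnt_eq_zero fun t ht => (hmem t (Or.inr ht)).1
  -- All remaining entries lie in the interval: the count at `c = a` is the size of the first
  -- column, and by the ballot condition it is the maximum.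
  constructor
  · intro h c _ _
    have := h2.ballot c
    omega
  · intro h
    have := h a le_rfl hab
    omega

/-! ### Comparison of the orders -/

theorem shape_cols_of_ne {A B : Finset ℕ} (hA : A ≠ ∅) (hB : B ≠ ∅) :
    shape (cols A B) = [A.card, B.card] := by
  simp [cols_of_ne hA hB, shape]

theorem shape_cols_empty_right {A : Finset ℕ} (hA : A ≠ ∅) : shape (cols A ∅) = [A.card] := by
  simp [cols_empty_right hA, shape]

/-- The totals agree, so with at most two columns only the first partial sum matters. -/
theorem dominanceLE_cols_iff {A B A' B' : Finset ℕ} (hv : Valid A B) (hv' : Valid A' B')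
    (hu : A ∪ B = A' ∪ B') : DominanceLE (shape (cols A B)) (shape (cols A' B')) ↔
      A.card ≤ A'.card := by
  have hc : A.card + B.card = A'.card + B'.card := by
    rw [← Finset.card_union_of_disjoint hv.disj, hu, Finset.card_union_of_disjoint hv'.disj]
  by_cases hA : A = ∅
  · have hB := hv.right_eq_empty hA
    subst hA hB
    simp only [cols_empty, shape, Finset.card_empty, Nat.zero_le, iff_true]
    intro i h1 h2
    simp at h2
    omega
  have hA' : A' ≠ ∅ := by
    intro hA'
    have hB' := hv'.right_eq_empty hA'
    subst hA' hB'
    have : A.card = 0 := by simp at hc; simp [hc.1]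
    exact hA (Finset.card_eq_zero.1 this)
  have key : ∀ (A B : Finset ℕ), A ≠ ∅ → 1 ≤ (shape (cols A B)).length ∧
      (shape (cols A B)).length ≤ 2 ∧ ((shape (cols A B)).take 1).sum = A.card ∧
      ((shape (cols A B)).take 2).sum = A.card + B.card := by
    intro A B hA
    by_cases hB : B = ∅
    · subst hB
      simp [shape_cols_empty_right hA]
    · simp [shape_cols_of_ne hA hB]
  obtain ⟨h1, h2, h3, h4⟩ := key A B hA
  obtain ⟨h1', h2', h3', h4'⟩ := key A' B' hA'
  constructor
  · intro h
    have := h 1 le_rfl (by omega)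
    omega
  · intro h i hi1 hi2
    have : i = 1 ∨ i = 2 := by omega
    rcases this with rfl | rfl <;> omega

theorem length_le_length_flatten {T : List (List ℕ)} (h : ∀ C ∈ T, C ≠ []) :
    T.length ≤ T.flatten.length := by
  induction T with
  | nil => simp
  | cons C T ih =>
    have h1 := ih fun D hD => h D (by simp [hD])
    have h2 := List.length_pos_iff.2 (h C (by simp))
    simp only [List.length_cons, List.flatten_cons, List.length_append]
    omega

theorem proj_eq_self {T : List (List ℕ)} {a b : ℕ} (h : ∀ t ∈ T.flatten, a ≤ t ∧ t ≤ b) :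
    proj a b T = T := by
  have h1 : T.flatten.filter (· < a) = [] := List.filter_eq_nil_iff.2 fun t ht => by
    have := h t ht
    simp; omega
  have h2 : T.flatten.filter (b < ·) = [] := List.filter_eq_nil_iff.2 fun t ht => by
    have := h t ht
    simp; omega
  simp [proj, h1, h2]

/-- If `S` had more columns, its first `T.length` columns would miss a box, while those of `T`
contain all boxes. -/
theorem length_le_of_dominanceLE {T S : List (List ℕ)} (hS : ∀ C ∈ S, C ≠ [])
    (hp : T.flatten.length = S.flatten.length) (hT0 : T ≠ [])
    (h : DominanceLE (shape T) (shape S)) : S.length ≤ T.length := by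
  by_contra hlt
  have hT : 1 ≤ T.length := List.length_pos_iff.2 hT0
  have h1 := h T.length hT (by simp only [shape, List.length_map]; omega)
  have h2 : ((shape T).take T.length).sum = S.flatten.length := by
    rw [← hp, List.length_flatten]
    congr 1
    exact List.take_of_length_le (by simp [shape])
  have h3 : ((shape S).take T.length).sum + (S.drop T.length).flatten.length =
      S.flatten.length := by
    rw [List.length_flatten, List.length_flatten, ← List.sum_append, List.map_drop]
    exact congrArg List.sum (List.take_append_drop _ _)
  have h4 := length_le_length_flatten (T := S.drop T.length) fun C hC => hS C (List.mem_of_mem_drop hC)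
  rw [List.length_drop] at h4
  omega

/-- The projection to the interval from the least to the greatest entry changes nothing, so the
shapes themselves are comparable. With at most one entry there is no pair `a < b` to test, and the
bound is immediate. -/
theorem ChainLE.length_le {A B : Finset ℕ} {S : List (List ℕ)} (h : ChainLE (cols A B) S) :
    S.length ≤ 2 := by
  obtain ⟨_, hS, hp, h⟩ := h
  by_cases hc : S.flatten.length ≤ 1
  · exact (length_le_length_flatten hS.col_ne_nil).trans (hc.trans (by norm_num))
  · have hmem : ∀ t, t ∈ (cols A B).flatten ↔ t ∈ (cols A B).flatten.toFinset := by simp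
    have hcard : 1 < (cols A B).flatten.toFinset.card := by
      rw [List.toFinset_card_of_nodup (hp.nodup_iff.2 hS.nodup), hp.length_eq]
      omega
    have hne : (cols A B).flatten.toFinset.Nonempty := Finset.card_pos.1 (by omega)
    have h1 := h _ ((hmem _).2 (Finset.min'_mem _ hne)) _ ((hmem _).2 (Finset.max'_mem _ hne))
      (Finset.min'_lt_max'_of_card _ hcard)
    have hb : ∀ t ∈ (cols A B).flatten, (cols A B).flatten.toFinset.min' hne ≤ t ∧
        t ≤ (cols A B).flatten.toFinset.max' hne := fun t ht =>
      ⟨Finset.min'_le _ t ((hmem t).1 ht), Finset.le_max' _ t ((hmem t).1 ht)⟩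
    rw [proj_eq_self hb, proj_eq_self fun t ht => hb t (hp.mem_iff.2 ht)] at h1
    refine (length_le_of_dominanceLE hS.col_ne_nil hp.length_eq ?_ h1).trans (cols_length_le A B)
    intro h0
    simp [h0] at hcard

theorem chainLE_iff {A B : Finset ℕ} (hv : Valid A B) {S : List (List ℕ)} :
    ChainLE (cols A B) S ↔ ∃ A' B', Valid A' B' ∧ S = cols A' B' ∧ A ∪ B = A' ∪ B' ∧
      ∀ a ∈ A ∪ B, ∀ b ∈ A ∪ B, a < b →
        ∀ k, MaxLE A' B' a (b + 1) k → MaxLE A B a (b + 1) k := by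
  have key : ∀ A' B', Valid A' B' → A ∪ B = A' ∪ B' → ∀ a b, a < b →
      (DominanceLE (shape (proj a b (cols A B))) (shape (proj a b (cols A' B'))) ↔
        ∀ k, MaxLE A' B' a (b + 1) k → MaxLE A B a (b + 1) k) := by
    intro A' B' hv' hu a b hab
    obtain ⟨A₁, B₁, h1, h2, h3, h4⟩ := hv.proj (a := a) (b := b) (by omega)
    obtain ⟨A₁', B₁', h1', h2', h3', h4'⟩ := hv'.proj (a := a) (b := b) (by omega)
    rw [h1, h1', dominanceLE_cols_iff h2 h2' (by rw [h3, h3', hu])]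
    constructor
    · exact fun h k hk => (h4 k).1 (h.trans ((h4' k).2 hk))
    · exact fun h => (h4 _).2 (h _ ((h4' _).1 le_rfl))
  constructor
  · intro h
    obtain ⟨A', B', hv', rfl⟩ := h.2.1.exists_cols h.length_le
    have hu : A ∪ B = A' ∪ B' := by
      ext t
      rw [← mem_flatten_cols, ← mem_flatten_cols, h.2.2.1.mem_iff]
    refine ⟨A', B', hv', rfl, hu, fun a ha b hb hab => ?_⟩
    exact (key A' B' hv' hu a b hab).1
      (h.2.2.2 a (mem_flatten_cols.2 ha) b (mem_flatten_cols.2 hb) hab)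
  · rintro ⟨A', B', hv', rfl, hu, h⟩
    refine ⟨hv.isTableau, hv'.isTableau, ?_, fun a ha b hb hab => ?_⟩
    · refine List.perm_of_nodup_nodup_toFinset_eq hv.nodup_flatten hv'.nodup_flatten ?_
      ext t
      rw [List.mem_toFinset, List.mem_toFinset, mem_flatten_cols, mem_flatten_cols, hu]
    · exact (key A' B' hv' hu a b hab).2
        (h a (mem_flatten_cols.1 ha) b (mem_flatten_cols.1 hb) hab)

/-- On two-column tableaux the relation `le` is the order by balanced intervals. -/
def IsBalOrder (le : List (List ℕ) → List (List ℕ) → Prop) : Prop :=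
  ∀ A B, Valid A B → ∀ S, le (cols A B) S ↔
    ∃ A' B', Valid A' B' ∧ S = cols A' B' ∧ BalLE A B A' B'

theorem isBalOrder_dufloLE : IsBalOrder DufloLE := by
  intro A B hv S
  constructor
  · intro h
    obtain ⟨A', B', hv', rfl, hu, hm⟩ := h.exists_cols hv
    exact ⟨A', B', hv', rfl, hu, fun a _ b _ hab hb =>
      Bal.of_maxLE hv hv' hu (by omega) (hm a (b + 1)) hb⟩
  · rintro ⟨A', B', hv', rfl, h⟩
    exact h.dufloLE hv hv'

/-- Balanced intervals alone do not directly bound the other projections. The converse goes through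
the induced weak order, which compares all `MaxLE` bounds. -/
theorem isBalOrder_chainLE : IsBalOrder ChainLE := by
  intro A B hv S
  rw [chainLE_iff hv]
  constructor
  · rintro ⟨A', B', hv', rfl, hu, h⟩
    exact ⟨A', B', hv', rfl, hu, fun a ha b hb hab hbal =>
      Bal.of_maxLE hv hv' hu (by omega) (h a ha b hb hab) hbal⟩
  · rintro ⟨A', B', hv', rfl, h⟩
    obtain ⟨A₁, B₁, hv₁, he, hu, hm⟩ := (h.dufloLE hv hv').exists_cols hv
    exact ⟨A₁, B₁, hv₁, he, hu, fun a _ b _ _ => hm a (b + 1)⟩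

theorem balLE_of_dufloLE {A B A' B' : Finset ℕ} (hv : Valid A B) (hv' : Valid A' B')
    (h : DufloLE (cols A B) (cols A' B')) : BalLE A B A' B' := by
  obtain ⟨A₁, B₁, hv₁, he, hb⟩ := (isBalOrder_dufloLE A B hv _).1 h
  obtain ⟨rfl, rfl⟩ := hv'.cols_inj hv₁ he
  exact hb

theorem BalLE.trans {A B A' B' A'' B'' : Finset ℕ} (h : BalLE A B A' B')
    (h' : BalLE A' B' A'' B'') : BalLE A B A'' B'' :=
  ⟨h.union.trans h'.union, fun a ha b hb hab hbal =>
    h.bal a ha b hb hab (h'.bal a (h.union ▸ ha) b (h.union ▸ hb) hab hbal)⟩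

section Order

variable {le : List (List ℕ) → List (List ℕ) → Prop} {A B : Finset ℕ} {S : List (List ℕ)}

theorem IsBalOrder.lt_iff (hle : IsBalOrder le) (hv : Valid A B) : Lt le (cols A B) S ↔
    ∃ A' B', Valid A' B' ∧ S = cols A' B' ∧ BalLE A B A' B' ∧ B ≠ B' := by
  unfold Lt
  rw [hle A B hv]
  constructor
  · rintro ⟨⟨A', B', hv', rfl, h⟩, hne⟩
    exact ⟨A', B', hv', rfl, h, fun hB => hne (by rw [hv.left_eq hv' h.union hB, hB])⟩
  · rintro ⟨A', B', hv', rfl, h, hne⟩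
    exact ⟨⟨A', B', hv', rfl, h⟩, fun he => hne (hv.cols_inj hv' he).2⟩

theorem BalLE.card_lt {A' B' : Finset ℕ} (h : BalLE A B A' B') (hv' : Valid A' B')
    (hne : B ≠ B') : B'.card < B.card :=
  Finset.card_lt_card ((h.right_subset hv').ssubset_of_ne hne.symm)

/-- Going up strictly shrinks the second column, and `BalLE.exists_move` always provides an
intermediate element exactly one box away. -/
theorem IsBalOrder.mem_cover_iff (hle : IsBalOrder le) (hv : Valid A B) : S ∈ cover le (cols A B) ↔
    ∃ A' B', Valid A' B' ∧ S = cols A' B' ∧ BalLE A B A' B' ∧ B'.card + 1 = B.card := by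
  constructor
  · rintro ⟨hlt, hcov⟩
    obtain ⟨A', B', hv', rfl, h, hne⟩ := (hle.lt_iff hv).1 hlt
    refine ⟨A', B', hv', rfl, h, ?_⟩
    obtain ⟨j, hj, h1, h2, h3⟩ := h.exists_move hv hv' hne
    by_cases he : B.erase j = B'
    · rw [← he, Finset.card_erase_add_one hj]
    · refine absurd ⟨_, (hle.lt_iff hv).2 ⟨_, _, h1, rfl, balLE_of_dufloLE hv h1 h2, ?_⟩,
        (hle.lt_iff h1).2 ⟨A', B', hv', rfl, h3, he⟩⟩ hcov
      exact fun hB => Finset.notMem_erase j B (hB ▸ hj)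
  · rintro ⟨A', B', hv', rfl, h, hcard⟩
    refine ⟨(hle.lt_iff hv).2 ⟨A', B', hv', rfl, h, fun hB => ?_⟩, ?_⟩
    · rw [hB] at hcard
      omega
    · rintro ⟨P, hP1, hP2⟩
      obtain ⟨A₁, B₁, hv₁, rfl, h1, hne1⟩ := (hle.lt_iff hv).1 hP1
      obtain ⟨A₂, B₂, hv₂, he, h2, hne2⟩ := (hle.lt_iff hv₁).1 hP2
      obtain ⟨rfl, rfl⟩ := hv'.cols_inj hv₂ he
      have := h1.card_lt hv₁ hne1
      have := h2.card_lt hv' hne2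
      omega

end Order

/-! ### Adding and removing the greatest entry -/

theorem cnt_insert_of_le {A : Finset ℕ} {x c : ℕ} (h : c ≤ x) : cnt (insert x A) c = cnt A c :=
  cnt_congr fun t ht => by
    have : t ≠ x := by omega
    simp [this]

theorem Bal.notMem_left {A B : Finset ℕ} {a b : ℕ} (h : Bal A B a (b + 1)) (hab : a ≤ b)
    (hv : Valid A B) : b ∉ A := by
  intro hb
  have h1 := h.1 b hab (Nat.le_succ b)
  have h2 := h.2
  rw [cnt_succ, cnt_succ, if_pos hb, if_neg (hv.notMem_right hb)] at h2
  omega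

theorem Bal.notMem_right {A B : Finset ℕ} {a b : ℕ} (h : Bal A B a b) (hab : a < b)
    (hv : Valid A B) : a ∉ B := by
  intro hb
  have h1 := h.1 (a + 1) (Nat.le_succ a) hab
  rw [cnt_succ, cnt_succ, if_pos hb, if_neg fun h => hv.notMem_right h hb] at h1
  omega

theorem Bal.congr {A B A' B' : Finset ℕ} {a b : ℕ} (hab : a ≤ b)
    (hA : ∀ c, a ≤ c → c ≤ b → cnt A c = cnt A' c) (hB : ∀ c, a ≤ c → c ≤ b → cnt B c = cnt B' c)
    (h : Bal A B a b) : Bal A' B' a b := by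
  constructor
  · intro c hac hcb
    rw [← hA c hac hcb, ← hB c hac hcb, ← hA a le_rfl hab, ← hB a le_rfl hab]
    exact h.1 c hac hcb
  · rw [← hA b hab le_rfl, ← hB b hab le_rfl, ← hA a le_rfl hab, ← hB a le_rfl hab]
    exact h.2

theorem BalLE.erase_max {A B A' B' : Finset ℕ} {x : ℕ} (h : BalLE A B A' B')
    (hmax : ∀ t ∈ A ∪ B, t ≤ x) :
    BalLE (A.erase x) (B.erase x) (A'.erase x) (B'.erase x) := by
  refine ⟨by rw [← Finset.erase_union_distrib, h.union, Finset.erase_union_distrib],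
    fun a ha b hb hab hbal => ?_⟩
  rw [← Finset.erase_union_distrib, Finset.mem_erase] at ha hb
  have hbx : b < x := by
    have := hmax b hb.2
    omega
  have hc : ∀ C : Finset ℕ, ∀ c, a ≤ c → c ≤ b + 1 → cnt (C.erase x) c = cnt C c := fun C c _ hc =>
    cnt_erase_of_le (by omega)
  exact (h.bal a ha.2 b hb.2 hab (hbal.congr (by omega) (hc A') (hc B'))).congr (by omega)
    (fun c h1 h2 => (hc A c h1 h2).symm) (fun c h1 h2 => (hc B c h1 h2).symm)

theorem Valid.insert_max {A B : Finset ℕ} {x : ℕ} (hv : Valid A B) (hx : 0 < x)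
    (hmax : ∀ t ∈ A ∪ B, t < x) : Valid (insert x A) B := by
  have hxA : x ∉ A := fun h => lt_irrefl x (hmax x (Finset.mem_union_left _ h))
  have hxB : x ∉ B := fun h => lt_irrefl x (hmax x (Finset.mem_union_right _ h))
  refine ⟨by simp [hv.disj, hxB], fun t ht => ?_, fun c => ?_⟩
  · rw [Finset.insert_union, Finset.mem_insert] at ht
    rcases ht with rfl | ht
    · exact hx
    · exact hv.pos t ht
  · have := hv.ballot c
    rw [cnt_insert hxA]
    omega

/-- A balanced interval cannot end at the opening bracket `x`, so no new condition arises. -/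
theorem BalLE.insert_max {A B A' B' : Finset ℕ} {x : ℕ} (h : BalLE A B A' B')
    (hv' : Valid A' B') (hx : 0 < x) (hmax : ∀ t ∈ A ∪ B, t < x) :
    BalLE (insert x A) B (insert x A') B' := by
  refine ⟨by rw [Finset.insert_union, h.union, Finset.insert_union],
    fun a ha b hb hab hbal => ?_⟩
  rw [Finset.insert_union, Finset.mem_insert] at ha hb
  have hbx : b ≠ x := by
    rintro rfl
    exact hbal.notMem_left hab.le (hv'.insert_max hx (h.union ▸ hmax)) (Finset.mem_insert_self _ _)
  have hb' : b ∈ A ∪ B := by simpa [hbx] using hb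
  have hbx' := hmax b hb'
  have ha' : a ∈ A ∪ B := by
    have : a ≠ x := by omega
    simpa [this] using ha
  have hc : ∀ C : Finset ℕ, ∀ c, a ≤ c → c ≤ b + 1 → cnt (insert x C) c = cnt C c :=
    fun C c _ hc => cnt_insert_of_le (by omega)
  exact (h.bal a ha' b hb' hab (hbal.congr (by omega) (hc A') fun _ _ _ => rfl)).congr (by omega)
    (fun c h1 h2 => (hc A c h1 h2).symm) fun _ _ _ => rfl

theorem Valid.tabInsert_max {A B : Finset ℕ} {x : ℕ} (hv : Valid A B)
    (hmax : ∀ t ∈ A ∪ B, t < x) : tabInsert x (cols A B) = cols (insert x A) B :=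
  tabInsert_cols_of_forall_lt hv.right_eq_empty fun a ha => hmax a (Finset.mem_union_left _ ha)

section FirstColumn

variable {le : List (List ℕ) → List (List ℕ) → Prop} {A B : Finset ℕ} {x : ℕ}

theorem lt_erase_max {t : ℕ} (hmax : ∀ t ∈ A ∪ B, t ≤ x)
    (ht : t ∈ A.erase x ∪ B.erase x) : t < x := by
  rw [← Finset.erase_union_distrib, Finset.mem_erase] at ht
  have := hmax t ht.2
  omega

/-- The elements above a tableau with the greatest entry in the first column. -/
theorem IsBalOrder.lt_iff_of_max_mem_left (hle : IsBalOrder le) (hv : Valid A B) (hx : x ∈ A)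
    (hmax : ∀ t ∈ A ∪ B, t ≤ x) (S : List (List ℕ)) : Lt le (cols A B) S ↔
      ∃ S', Lt le (cols (A.erase x) (B.erase x)) S' ∧ S = tabInsert x S' := by
  have hxB : x ∉ B := hv.notMem_right hx
  have hv₀ := (jdtRemove_max hv (Finset.mem_union_left _ hx) hmax).2
  have hlt : ∀ t ∈ A.erase x ∪ B.erase x, t < x := fun t => lt_erase_max hmax
  have hx0 : 0 < x := hv.pos x (Finset.mem_union_left _ hx)
  rw [hle.lt_iff hv]
  constructor
  · rintro ⟨A', B', hv', rfl, h, hne⟩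
    have hxB' : x ∉ B' := fun h' => hxB (h.right_subset hv' h')
    have hxA' : x ∈ A' := by
      have : x ∈ A' ∪ B' := h.union ▸ Finset.mem_union_left _ hx
      simpa [hxB'] using this
    have hv₀' := (jdtRemove_max hv' (Finset.mem_union_left _ hxA') (h.union ▸ hmax)).2
    have h₀ := h.erase_max hmax
    refine ⟨_, (hle.lt_iff hv₀).2 ⟨_, _, hv₀', rfl, h₀, ?_⟩, ?_⟩
    · rwa [Finset.erase_eq_of_notMem hxB, Finset.erase_eq_of_notMem hxB']
    · rw [hv₀'.tabInsert_max (h₀.union ▸ hlt), Finset.insert_erase hxA',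
        Finset.erase_eq_of_notMem hxB']
  · rintro ⟨S', hS', rfl⟩
    obtain ⟨A', B', hv', rfl, h, hne⟩ := (hle.lt_iff hv₀).1 hS'
    have h₁ := h.insert_max hv' hx0 hlt
    have hlt' : ∀ t ∈ A' ∪ B', t < x := h.union ▸ hlt
    rw [Finset.insert_erase hx, Finset.erase_eq_of_notMem hxB] at h₁
    refine ⟨_, _, hv'.insert_max hx0 hlt', hv'.tabInsert_max hlt', h₁, ?_⟩
    rwa [Finset.erase_eq_of_notMem hxB] at hne

/-- The cover of a tableau with the greatest entry in the first column. -/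
theorem IsBalOrder.cover_of_max_mem_left (hle : IsBalOrder le) (hv : Valid A B) (hx : x ∈ A)
    (hmax : ∀ t ∈ A ∪ B, t ≤ x) : cover le (cols A B) =
      {S | ∃ S' ∈ cover le (cols (A.erase x) (B.erase x)), S = tabInsert x S'} := by
  have hxB : x ∉ B := hv.notMem_right hx
  have hv₀ := (jdtRemove_max hv (Finset.mem_union_left _ hx) hmax).2
  have hlt : ∀ t ∈ A.erase x ∪ B.erase x, t < x := fun t => lt_erase_max hmax
  have hx0 : 0 < x := hv.pos x (Finset.mem_union_left _ hx)
  ext S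
  rw [Set.mem_ofPred_eq]
  constructor
  · intro hS
    obtain ⟨A', B', hv', hS1, h, hcard⟩ := (hle.mem_cover_iff hv).1 hS
    obtain ⟨S', hS', hS2⟩ := (hle.lt_iff_of_max_mem_left hv hx hmax S).1 hS.1
    obtain ⟨A₁, B₁, hv₁, rfl, h₁, hne⟩ := (hle.lt_iff hv₀).1 hS'
    have hlt₁ : ∀ t ∈ A₁ ∪ B₁, t < x := h₁.union ▸ hlt
    refine ⟨_, (hle.mem_cover_iff hv₀).2 ⟨A₁, B₁, hv₁, rfl, h₁, ?_⟩, hS2⟩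
    rw [hS1, hv₁.tabInsert_max hlt₁] at hS2
    rw [← (hv'.cols_inj (hv₁.insert_max hx0 hlt₁) hS2).2, Finset.erase_eq_of_notMem hxB, hcard]
  · rintro ⟨S', hS', rfl⟩
    obtain ⟨A', B', hv', rfl, h, hcard⟩ := (hle.mem_cover_iff hv₀).1 hS'
    have h₁ := h.insert_max hv' hx0 hlt
    have hlt' : ∀ t ∈ A' ∪ B', t < x := h.union ▸ hlt
    rw [Finset.insert_erase hx, Finset.erase_eq_of_notMem hxB] at h₁
    rw [Finset.erase_eq_of_notMem hxB] at hcard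
    exact (hle.mem_cover_iff hv).2 ⟨_, _, hv'.insert_max hx0 hlt', hv'.tabInsert_max hlt', h₁,
      hcard⟩

end FirstColumn

/-! ### The greatest entry in the second column -/

/-- The situation of a tableau whose greatest entry `x` is in the second column; `m` is the greatest
entry of the first column. -/
structure MaxRight (A B : Finset ℕ) (m x : ℕ) : Prop where
  valid : Valid A B
  right : x ∈ B
  max : ∀ t ∈ A ∪ B, t ≤ x
  left : m ∈ A
  max_left : ∀ t ∈ A, t ≤ m

namespace MaxRight

variable {A B : Finset ℕ} {m x : ℕ}

theorem notMem (h : MaxRight A B m x) : x ∉ A := fun hx => h.valid.notMem_right hx h.right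

theorem lt (h : MaxRight A B m x) : m < x := by
  have h1 := h.max m (Finset.mem_union_left _ h.left)
  have h2 : m ≠ x := fun he => h.notMem (he ▸ h.left)
  omega

theorem pos (h : MaxRight A B m x) : 0 < x := h.valid.pos x (Finset.mem_union_right _ h.right)

theorem notMem_erase (h : MaxRight A B m x) : x ∉ A.erase m :=
  fun hx => h.notMem (Finset.mem_of_mem_erase hx)

theorem cnt_left (h : MaxRight A B m x) (c : ℕ) :
    cnt (insert x (A.erase m)) c + (if m < c then 1 else 0) =
      cnt A c + if x < c then 1 else 0 := by
  have := cnt_erase h.left c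
  rw [cnt_insert h.notMem_erase]
  omega

theorem cnt_right (h : MaxRight A B m x) (c : ℕ) :
    cnt (B.erase x) c + (if x < c then 1 else 0) = cnt B c := cnt_erase h.right c

theorem union_delete (h : MaxRight A B m x) :
    insert x (A.erase m) ∪ B.erase x = (A ∪ B).erase m := by
  rw [Finset.insert_union, ← Finset.union_insert, Finset.insert_erase h.right,
    Finset.erase_union_distrib, Finset.erase_eq_of_notMem (h.valid.notMem_right h.left)]

theorem cnt_eq_card (h : MaxRight A B m x) {c : ℕ} (hc : m < c) : cnt A c = A.card :=
  YoungTab.cnt_eq_card fun t ht => (h.max_left t ht).trans_lt hc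

/-- Beyond `m` all of `A` has been counted, and the inequality follows from `B.card ≤ A.card` after
lowering both by one. -/
theorem valid_delete (h : MaxRight A B m x) : Valid (insert x (A.erase m)) (B.erase x) := by
  refine ⟨?_, fun t ht => h.valid.pos t ?_, fun c => ?_⟩
  · rw [Finset.disjoint_insert_left]
    exact ⟨Finset.notMem_erase _ _,
      h.valid.disj.mono (Finset.erase_subset _ _) (Finset.erase_subset _ _)⟩
  · rw [h.union_delete] at ht
    exact Finset.mem_of_mem_erase ht
  · have h1 := h.cnt_left c
    have h2 := h.cnt_right c
    have h3 := h.valid.ballot c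
    have h4 := h.lt
    by_cases hc : m < c
    · have h5 := h.cnt_eq_card hc
      have h6 := h.valid.card_le
      have h7 := cnt_le_card (B.erase x) c
      rw [Finset.card_erase_of_mem h.right] at h7
      have h8 := Finset.card_pos.2 ⟨x, h.right⟩
      split_ifs at h1 h2 <;> omega
    · split_ifs at h1 h2 <;> omega

theorem tabInsert_delete (h : MaxRight A B m x) :
    tabInsert m (cols (insert x (A.erase m)) (B.erase x)) = cols A B := by
  have h1 := h.lt
  rw [tabInsert_cols_of_bump (z := x) ?_ (Finset.mem_insert_self _ _) h1 ?_ ?_]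
  · rw [Finset.erase_insert h.notMem_erase, Finset.insert_erase h.left,
      Finset.insert_erase h.right]
  · simp [h1.ne]
  · intro a ha hax
    rcases Finset.mem_insert.1 ha with rfl | ha
    · omega
    · have := h.max_left a (Finset.mem_of_mem_erase ha)
      have := Finset.ne_of_mem_erase ha
      omega
  · intro b hb
    have := h.max b (Finset.mem_union_right _ (Finset.mem_of_mem_erase hb))
    have := Finset.ne_of_mem_erase hb
    omega

theorem valid_erase (h : MaxRight A B m x) : Valid A (B.erase x) := by
  have := (jdtRemove_max h.valid (Finset.mem_union_right _ h.right) h.max).2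
  rwa [Finset.erase_eq_of_notMem h.notMem] at this

theorem lt_of_mem_erase (h : MaxRight A B m x) {t : ℕ} (ht : t ∈ A ∪ B.erase x) : t < x := by
  rw [← Finset.erase_eq_of_notMem h.notMem] at ht
  exact lt_erase_max h.max ht

theorem valid_move (h : MaxRight A B m x) : Valid (insert x A) (B.erase x) :=
  h.valid_erase.insert_max h.pos fun _ => h.lt_of_mem_erase

theorem balLE_move (h : MaxRight A B m x) : BalLE A B (insert x A) (B.erase x) := by
  refine balLE_of_dufloLE h.valid h.valid_move (dufloLE_move h.valid h.right fun c hc => ?_).2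
  have h1 := cnt_mono A hc.le
  have h2 := cnt_succ B x
  have h3 : cnt B (x + 1) = cnt B c := cnt_eq_of_gap hc fun t ht hxt => by
    have := h.max t (Finset.mem_union_right _ ht)
    omega
  rw [if_pos h.right] at h2
  omega

/-- The greatest entries of the first columns agree. -/
theorem of_balLE {A' B' : Finset ℕ} (h : MaxRight A B m x) (hv' : Valid A' B')
    (hle : BalLE A B A' B') (hx : x ∈ B') : MaxRight A' B' m x := by
  have hmU : m ∈ A' ∪ B' := hle.union ▸ Finset.mem_union_left _ h.left
  have hmB : m ∉ B' := fun hm => h.valid.notMem_right h.left (hle.right_subset hv' hm)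
  refine ⟨hv', hx, hle.union ▸ h.max, by simpa [hmB] using hmU, fun t ht => ?_⟩
  by_contra hmt
  have htU : t ∈ A ∪ B := hle.union ▸ Finset.mem_union_left _ ht
  have htB : t ∈ B := by
    rcases Finset.mem_union.1 htU with htA | htB
    · exact absurd (h.max_left t htA) hmt
    · exact htB
  -- The interval from the partner `i` of `x` to `x` is balanced in both tableaux and `i ≤ m`. An
  -- entry `t > m` lies in it and closes in `B`, so it closes in `B'`.
  obtain ⟨i, hi, hix, hbal⟩ := hv'.exists_partner hx
  have hiU : i ∈ A ∪ B := hle.union ▸ Finset.mem_union_left _ hi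
  have hiA : i ∈ A := by
    have : i ∉ B := (hle.bal i hiU x (Finset.mem_union_right _ h.right) hix hbal).notMem_right
      (by omega) h.valid
    simpa [this] using hiU
  have him := h.max_left i hiA
  exact hv'.notMem_right ht (hle.mem_of_bal h.valid hv' hiU (Finset.mem_union_right _ h.right) hix
    hbal (by omega) (h.max t htU) htB)

/-- Deletion of the greatest entry respects the order if the entries between `m` and `x` are
consecutive. -/
theorem balLE_delete {A' B' : Finset ℕ} (h : MaxRight A B m x) (h' : MaxRight A' B' m x)
    (hle : BalLE A B A' B') (hcons : ∀ t, m < t → t ≤ x → t ∈ A ∪ B) :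
    BalLE (insert x (A.erase m)) (B.erase x) (insert x (A'.erase m)) (B'.erase x) := by
  refine ⟨by rw [h.union_delete, h'.union_delete, hle.union], fun a ha b hb hab hbal => ?_⟩
  rw [h.union_delete, Finset.mem_erase] at ha hb
  have hmx := h.lt
  have hbx : b < x := by
    have h1 := h.max b hb.2
    have h2 : b ≠ x := by
      rintro rfl
      exact hbal.notMem_left hab.le h'.valid_delete (Finset.mem_insert_self _ _)
    omega
  have memB : ∀ {A B : Finset ℕ}, MaxRight A B m x → (∀ t, m < t → t ≤ x → t ∈ A ∪ B) →
      ∀ t, m < t → t ≤ x → t ∈ B := by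
    intro A B h hcons t hmt htx
    rcases Finset.mem_union.1 (hcons t hmt htx) with ht | ht
    · have := h.max_left t ht
      omega
    · exact ht
  have memB₁ := memB h hcons
  have memB₂ := memB h' (hle.union ▸ hcons)
  have eA : ∀ {A B : Finset ℕ}, MaxRight A B m x → ∀ c, c ≤ m →
      cnt (insert x (A.erase m)) c = cnt A c ∧ cnt (B.erase x) c = cnt B c := by
    intro A B h c hc
    have h1 := h.cnt_left c
    have h2 := h.cnt_right c
    split_ifs at h1 h2 <;> omega
  have eB : ∀ {A B : Finset ℕ}, MaxRight A B m x → ∀ c, m < c → c ≤ x →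
      cnt (insert x (A.erase m)) c + 1 = A.card ∧ cnt (B.erase x) c = cnt B c := by
    intro A B h c hc hcx
    have h1 := h.cnt_left c
    have h2 := h.cnt_right c
    have h3 := h.cnt_eq_card hc
    split_ifs at h1 h2 <;> omega
  have eS : ∀ {A B : Finset ℕ}, MaxRight A B m x → cnt A m + 1 = A.card := by
    intro A B h
    have h1 := cnt_succ A m
    rw [if_pos h.left, h.cnt_eq_card (Nat.lt_succ_self m)] at h1
    omega
  -- Up to `m` the deletion changes no counts. The other case is `m < b < x`, as `m` is no longer an
  -- entry and `x` now opens.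
  by_cases hbm : b < m
  · have h1 := hle.bal a ha.2 b hb.2 hab (hbal.congr (by omega)
      (fun c _ hc => (eA h' c (by omega)).1) (fun c _ hc => (eA h' c (by omega)).2))
    exact h1.congr (by omega)
      (fun c _ hc => (eA h c (by omega)).1.symm) (fun c _ hc => (eA h c (by omega)).2.symm)
  · have hmb : m < b := by have := hb.1; omega
    have ham : a < m := by
      by_contra ham
      have haB : a ∈ B' := memB₂ a (by have := ha.1; omega) (by omega)
      exact hbal.notMem_right (by omega) h'.valid_delete
        (Finset.mem_erase.2 ⟨by omega, haB⟩)
    have hsucc : ∀ c, m < c → c ≤ x → cnt B (c + 1) = cnt B c + 1 ∧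
        cnt B' (c + 1) = cnt B' c + 1 := fun c h1 h2 => by
      rw [cnt_succ, cnt_succ, if_pos (memB₁ c h1 h2), if_pos (memB₂ c h1 h2)]
      exact ⟨rfl, rfl⟩
    have s1 := eS h
    have s2 := eS h'
    have a1 := eA h a ham.le
    have a2 := eA h' a ham.le
    have hmB : cnt B (m + 1) = cnt B m ∧ cnt B' (m + 1) = cnt B' m := by
      rw [cnt_succ, cnt_succ, if_neg (h.valid.notMem_right h.left),
        if_neg (h'.valid.notMem_right h'.left)]
      exact ⟨rfl, rfl⟩
    -- Restoring the opening `m` is compensated by the next closing letter `b + 1`, which exists by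
    -- `hcons`. Beyond `m` the condition at `d + 1` is thus the one of the deletion at `d`;
    -- afterwards the same shift is undone for `A`, `B`.
    have hbal' : Bal A' B' a (b + 1 + 1) := by
      constructor
      · intro c hac hcb
        by_cases hcm : c ≤ m
        · have := hbal.1 c hac (by omega)
          have := eA h' c hcm
          omega
        · obtain ⟨d, rfl⟩ : ∃ d, c = d + 1 := ⟨c - 1, by omega⟩
          have h1 := hbal.1 d (by omega) (by omega)
          have h2 := h'.cnt_eq_card (c := d + 1) (by omega)
          by_cases hd : d = m
          · subst hd
            have := eA h' d le_rfl
            omega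
          · have h3 := eB h' d (by omega) (by omega)
            have h4 := hsucc d (by omega) (by omega)
            omega
      · have h1 := hbal.2
        have h2 := h'.cnt_eq_card (c := b + 1 + 1) (by omega)
        have h3 := eB h' (b + 1) (by omega) (by omega)
        have h4 := hsucc (b + 1) (by omega) (by omega)
        omega
    have h1 := hle.bal a ha.2 (b + 1) (hcons (b + 1) (by omega) (by omega)) (by omega) hbal'
    constructor
    · intro c hac hcb
      by_cases hcm : c ≤ m
      · have := h1.1 c hac (by omega)
        have := eA h c hcm
        omega
      · have h2 := h1.1 (c + 1) (by omega) (by omega)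
        have h3 := h.cnt_eq_card (c := c + 1) (by omega)
        have h4 := eB h c (by omega) (by omega)
        have h5 := hsucc c (by omega) (by omega)
        omega
    · have h2 := h1.2
      have h3 := h.cnt_eq_card (c := b + 1 + 1) (by omega)
      have h4 := eB h (b + 1) (by omega) (by omega)
      have h5 := hsucc (b + 1) (by omega) (by omega)
      omega

end MaxRight

theorem col₂_cols {A : Finset ℕ} (hA : A ≠ ∅) (B : Finset ℕ) : col₂ (cols A B) = B.sort := by
  by_cases hB : B = ∅
  · simp [hB, cols_empty_right hA, col₂]
  · simp [cols_of_ne hA hB, col₂]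

/-- As `x` in the first column exceeds `m`, insertion must bump an entry; with only two columns in
the result, it ends in the second. -/
theorem card_of_tabInsert {A B A' B' : Finset ℕ} {m x : ℕ} (hm : m ∉ A ∪ B) (hv : Valid A B)
    (hx : x ∈ A) (hmx : m < x) (hv' : Valid A' B') (h : tabInsert m (cols A B) = cols A' B') :
    B'.card = B.card + 1 := by
  have hmA : m ∉ A := fun h => hm (Finset.mem_union_left _ h)
  rcases insert_cases hmA with hlt | ⟨z, hz, hmz, hgap⟩
  · have := hlt x hx
    omega
  · have hzB := hv.notMem_right hz
    by_cases hB : ∀ b ∈ B, b < z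
    · rw [tabInsert_cols_of_bump hmA hz hmz hgap hB] at h
      have h1 := hv'.col₂_eq
      rw [← h, col₂_cols (by simp)] at h1
      rw [← Finset.length_sort (s := B') (· ≤ ·), ← h1, Finset.length_sort,
        Finset.card_insert_of_notMem hzB]
    · push Not at hB
      obtain ⟨b, hb, hzb⟩ := hB
      have hne : z ≠ b := fun he => hzB (he ▸ hb)
      have h1 := three_le_length_tabInsert hmA hz hmz hgap hb (by omega)
      have h2 := cols_length_le A' B'
      rw [h] at h1
      omega

section SecondColumn

variable {le : List (List ℕ) → List (List ℕ) → Prop} {A B : Finset ℕ} {m x : ℕ}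

/-- Insertion of the greatest entry `m` of the first column into a tableau above `T ⇐ x`. -/
theorem MaxRight.exists_tabInsert {A' B' : Finset ℕ} (h : MaxRight A B m x) (hv' : Valid A' B')
    (hle : BalLE (insert x (A.erase m)) (B.erase x) A' B') :
    ∃ A'' B'', Valid A'' B'' ∧ tabInsert m (cols A' B') = cols A'' B'' ∧ BalLE A B A'' B'' ∧
      B''.card = B'.card + 1 := by
  have hmU : m ∉ insert x (A.erase m) ∪ B.erase x := by
    rw [h.union_delete]
    exact Finset.notMem_erase _ _
  obtain ⟨A'', B'', hv'', he, hle''⟩ := (isBalOrder_dufloLE A B h.valid _).1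
    ((hle.dufloLE h.valid_delete hv').tabInsert h.valid_delete hmU h.valid h.tabInsert_delete)
  have hx' : x ∈ A' := by
    have h1 : x ∈ A' ∪ B' := hle.union ▸ Finset.mem_union_left _ (Finset.mem_insert_self _ _)
    have h2 : x ∉ B' := fun hx => Finset.notMem_erase x B (hle.right_subset hv' hx)
    simpa [h2] using h1
  exact ⟨A'', B'', hv'', he, hle'',
    card_of_tabInsert (hle.union ▸ hmU) hv' hx' h.lt hv'' he⟩

/-- The elements above a tableau with the greatest entry in the second column. -/
theorem IsBalOrder.lt_iff_of_max_mem_right (hle : IsBalOrder le) (h : MaxRight A B m x)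
    (hcons : ∀ t, m < t → t ≤ x → t ∈ A ∪ B) (S : List (List ℕ)) : Lt le (cols A B) S ↔
      (∃ S', le (cols A (B.erase x)) S' ∧ S = tabInsert x S') ∨
        ∃ S', Lt le (cols (insert x (A.erase m)) (B.erase x)) S' ∧ S = tabInsert m S' := by
  have hlt : ∀ t ∈ A ∪ B.erase x, t < x := fun t => h.lt_of_mem_erase
  rw [hle.lt_iff h.valid]
  constructor
  · rintro ⟨A', B', hv', rfl, hb, hne⟩
    -- The two alternatives of the statement correspond to the column of `S` that contains `x`.
    by_cases hxB : x ∈ B'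
    · right
      have h' := h.of_balLE hv' hb hxB
      refine ⟨_, (hle.lt_iff h.valid_delete).2
        ⟨_, _, h'.valid_delete, rfl, h.balLE_delete h' hb hcons, fun he => hne ?_⟩,
        h'.tabInsert_delete.symm⟩
      rw [← Finset.insert_erase h.right, he, Finset.insert_erase hxB]
    · left
      have hxA : x ∈ A' := by
        have : x ∈ A' ∪ B' := hb.union ▸ Finset.mem_union_right _ h.right
        simpa [hxB] using this
      have hv₀ := (jdtRemove_max hv' (Finset.mem_union_left _ hxA) (hb.union ▸ h.max)).2
      have h₀ := hb.erase_max h.max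
      rw [Finset.erase_eq_of_notMem h.notMem] at h₀
      refine ⟨_, (hle _ _ h.valid_erase _).2 ⟨_, _, hv₀, rfl, h₀⟩, ?_⟩
      rw [hv₀.tabInsert_max (h₀.union ▸ hlt), Finset.insert_erase hxA,
        Finset.erase_eq_of_notMem hxB]
  · rintro (⟨S', hS', rfl⟩ | ⟨S', hS', rfl⟩)
    · obtain ⟨A', B', hv', rfl, hb⟩ := (hle _ _ h.valid_erase _).1 hS'
      have hlt' : ∀ t ∈ A' ∪ B', t < x := hb.union ▸ hlt
      refine ⟨_, _, hv'.insert_max h.pos hlt', hv'.tabInsert_max hlt',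
        h.balLE_move.trans (hb.insert_max hv' h.pos hlt), ?_⟩
      rintro rfl
      exact lt_irrefl x (hlt' x (Finset.mem_union_right _ h.right))
    · obtain ⟨A', B', hv', rfl, hb, hne⟩ := (hle.lt_iff h.valid_delete).1 hS'
      obtain ⟨A'', B'', hv'', he, hb'', hcard⟩ := h.exists_tabInsert hv' hb
      refine ⟨A'', B'', hv'', he, hb'', ?_⟩
      rintro rfl
      have h1 := hb.card_lt hv' hne
      rw [Finset.card_erase_of_mem h.right] at h1
      omega

/-- The cover of a tableau with the greatest entry in the second column. -/
theorem IsBalOrder.cover_of_max_mem_right (hle : IsBalOrder le) (h : MaxRight A B m x)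
    (hcons : ∀ t, m < t → t ≤ x → t ∈ A ∪ B) : cover le (cols A B) =
      {S | ∃ S'' ∈ cover le (cols (A.erase m) (B.erase x)), S = tabInsert m (tabInsert x S'')} ∪
        {cols (insert x A) (B.erase x)} := by
  have hlt : ∀ t ∈ A ∪ B.erase x, t < x := fun t => h.lt_of_mem_erase
  have hmax : ∀ t ∈ insert x (A.erase m) ∪ B.erase x, t ≤ x := fun t ht => by
    rw [h.union_delete] at ht
    exact h.max t (Finset.mem_of_mem_erase ht)
  -- In the tableau with the corner deleted, `x` is the greatest entry and lies in the first column,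
  -- so the other case describes its cover.
  have hcov := hle.cover_of_max_mem_left h.valid_delete (Finset.mem_insert_self _ _) hmax
  rw [Finset.erase_insert h.notMem_erase, Finset.erase_eq_of_notMem (Finset.notMem_erase x B)]
    at hcov
  have hBc := Finset.card_erase_add_one h.right
  ext S
  rw [Set.mem_union, Set.mem_ofPred_eq, Set.mem_singleton_iff]
  constructor
  · intro hS
    obtain ⟨A', B', hv', hS1, hb, hcard⟩ := (hle.mem_cover_iff h.valid).1 hS
    rcases (hle.lt_iff_of_max_mem_right h hcons S).1 hS.1 with ⟨S', hS', hS2⟩ | ⟨S', hS', hS2⟩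
    · right
      obtain ⟨A₁, B₁, hv₁, rfl, hb₁⟩ := (hle _ _ h.valid_erase _).1 hS'
      have hlt₁ : ∀ t ∈ A₁ ∪ B₁, t < x := hb₁.union ▸ hlt
      rw [hv₁.tabInsert_max hlt₁] at hS2
      have hB := (hv'.cols_inj (hv₁.insert_max h.pos hlt₁) (hS1.symm.trans hS2)).2
      -- The second column of a covering element loses a single box, and that box is `x`, so nothing
      -- else has moved.
      have hB₁ : B.erase x = B₁ := by
        by_contra hne
        have := hb₁.card_lt hv₁ hne
        rw [hB] at hcard
        omega
      have hA₁ := h.valid_erase.left_eq hv₁ hb₁.union hB₁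
      rw [hS2, hA₁, hB₁]
    · left
      obtain ⟨A₁, B₁, hv₁, rfl, hb₁, hne₁⟩ := (hle.lt_iff h.valid_delete).1 hS'
      obtain ⟨A'', B'', hv'', he, hb'', hcard''⟩ := h.exists_tabInsert hv₁ hb₁
      have hB := (hv'.cols_inj hv'' (hS1.symm.trans (hS2.trans he))).2
      have hc : cols A₁ B₁ ∈ cover le (cols (insert x (A.erase m)) (B.erase x)) :=
        (hle.mem_cover_iff h.valid_delete).2 ⟨A₁, B₁, hv₁, rfl, hb₁, by rw [hB] at hcard; omega⟩
      rw [hcov] at hc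
      obtain ⟨S'', hS'', he''⟩ := hc
      exact ⟨S'', hS'', by rw [hS2, he'']⟩
  · rintro (⟨S'', hS'', rfl⟩ | rfl)
    · have hc : tabInsert x S'' ∈ cover le (cols (insert x (A.erase m)) (B.erase x)) := by
        rw [hcov]
        exact ⟨S'', hS'', rfl⟩
      obtain ⟨A₁, B₁, hv₁, he₁, hb₁, hcard₁⟩ := (hle.mem_cover_iff h.valid_delete).1 hc
      obtain ⟨A'', B'', hv'', he, hb'', hcard''⟩ := h.exists_tabInsert hv₁ hb₁
      rw [he₁]
      exact (hle.mem_cover_iff h.valid).2 ⟨A'', B'', hv'', he, hb'', by omega⟩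
    · exact (hle.mem_cover_iff h.valid).2 ⟨_, _, h.valid_move, rfl, h.balLE_move, hBc⟩

end SecondColumn

/-! ### Translation of the operations on lists -/

theorem erase_sort (A : Finset ℕ) (x : ℕ) : A.sort.erase x = (A.erase x).sort := by
  symm
  refine sort_eq_of_pairwise ((pairwise_sort A).sublist List.erase_sublist) fun y => ?_
  rw [(A.sort_nodup _).mem_erase_iff, Finset.mem_sort, Finset.mem_erase]

theorem colAdd_sort {A : Finset ℕ} {x : ℕ} (hx : x ∉ A) : colAdd A.sort x = (insert x A).sort := by
  have hp := List.perm_orderedInsert (· ≤ ·) x A.sort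
  have hn : (x :: A.sort).Nodup := List.nodup_cons.2 ⟨by simpa using hx, A.sort_nodup _⟩
  have hs : (colAdd A.sort x).Pairwise (· ≤ ·) :=
    List.Pairwise.orderedInsert x A.sort ((pairwise_sort A).imp fun h => Nat.le_of_lt h)
  symm
  refine sort_eq_of_pairwise
    (hs.imp₂ (fun _ _ h h' => lt_of_le_of_ne h h') (hp.nodup_iff.2 hn)) fun y => ?_
  rw [colAdd, hp.mem_iff, List.mem_cons, Finset.mem_sort, Finset.mem_insert]

theorem proj_of_max {A B : Finset ℕ} {n : ℕ} (hv : Valid A B) (hn : n ∈ A ∪ B)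
    (hmax : ∀ t ∈ A ∪ B, t ≤ n) : proj 1 (n - 1) (cols A B) = cols (A.erase n) (B.erase n) := by
  have hn0 := hv.pos n hn
  have h1 : (cols A B).flatten.filter (· < 1) = [] := List.filter_eq_nil_iff.2 fun t ht => by
    have := hv.pos t (mem_flatten_cols.1 ht)
    simp; omega
  have h2 : (cols A B).flatten.filter (n - 1 < ·) = [n] := by
    refine List.perm_singleton.1
      ((List.perm_ext_iff_of_nodup (hv.nodup_flatten.filter _) (List.nodup_singleton n)).2
        fun t => ?_)
    rw [List.mem_filter, mem_flatten_cols, List.mem_singleton, decide_eq_true_eq]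
    constructor
    · rintro ⟨h, h'⟩
      have := hmax t h
      omega
    · rintro rfl
      exact ⟨hn, by omega⟩
  rw [proj]
  simp only [h1, h2, List.insertionSort_nil, List.nil_append]
  exact (jdtRemove_max hv hn hmax).1

theorem omega₁_cols {A B : Finset ℕ} {m : ℕ} (hv : Valid A B) (hm : m ∈ A)
    (hmax : ∀ t ∈ A, t ≤ m) : omega₁ (cols A B) = m := by
  rw [omega₁, hv.col₁_eq, sort_eq_append_of_max hm hmax]
  simp

theorem MaxRight.deleteCorner {A B : Finset ℕ} {m x : ℕ} (h : MaxRight A B m x) :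
    deleteCorner (cols A B) x = cols (insert x (A.erase m)) (B.erase x) := by
  have hA : A ≠ ∅ := Finset.ne_empty_of_mem h.left
  have h1 : A.sort.filter (· < x) = A.sort := List.filter_eq_self.2 fun t ht => by
    have := h.max_left t ((Finset.mem_sort _).1 ht)
    have := h.lt
    simp; omega
  have hs := sort_eq_append_of_max h.left h.max_left
  have h2 : colPush A.sort x = ((insert x (A.erase m)).sort, m) := by
    have hlt : ∀ a ∈ A.erase m, a < x := fun a ha =>
      (h.max_left a (Finset.mem_of_mem_erase ha)).trans_lt h.lt
    rw [colPush, h1, hs, List.getLast?_concat, sort_insert_of_forall_lt hlt]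
    simp only [List.map_append, List.map_cons, List.map_nil, if_true]
    congr 2
    refine (List.map_congr_left (g := id) fun t ht => ?_).trans (List.map_id _)
    rw [Finset.mem_sort, Finset.mem_erase] at ht
    simp [ht.1]
  rw [YoungTab.deleteCorner, cols_of_ne hA (Finset.ne_empty_of_mem h.right), deleteAux,
    if_neg (by simpa using h.notMem), deleteAux, if_pos (by simpa using h.right), h2, erase_sort,
    cols, ofCols_of_ne_nil (sort_ne_nil (by simp))]


end YoungTab

/-! ### The proposition for both orders -/

open YoungTab in
theorem proposition3p15
    (le : List (List ℕ) → List (List ℕ) → Prop)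
    (hle : le = YoungTab.DufloLE ∨ le = YoungTab.ChainLE)
    (n : ℕ) (T : List (List ℕ)) (hT : YoungTab.IsStandard n T) (hT2 : T.length ≤ 2) :
    (n ∈ YoungTab.col₁ T →
      (∀ S, YoungTab.Lt le T S ↔
        ∃ S', YoungTab.Lt le (YoungTab.proj 1 (n - 1) T) S' ∧ S = YoungTab.tabInsert n S') ∧
      YoungTab.cover le T =
        {S | ∃ S' ∈ YoungTab.cover le (YoungTab.proj 1 (n - 1) T),
          S = YoungTab.tabInsert n S'}) ∧
    (n ∈ YoungTab.col₂ T →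
      (∀ S, YoungTab.Lt le T S ↔
        (∃ S', le (YoungTab.proj 1 (n - 1) T) S' ∧ S = YoungTab.tabInsert n S') ∨
        (∃ S', YoungTab.Lt le (YoungTab.deleteCorner T n) S' ∧
          S = YoungTab.tabInsert (YoungTab.omega₁ T) S')) ∧
      YoungTab.cover le T =
        {S | ∃ S'' ∈ YoungTab.cover le (YoungTab.ofCols
            ((YoungTab.col₁ T).erase (YoungTab.omega₁ T)) ((YoungTab.col₂ T).erase n)),
          S = YoungTab.tabInsert (YoungTab.omega₁ T) (YoungTab.tabInsert n S'')} ∪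
        {YoungTab.ofCols (YoungTab.colAdd (YoungTab.col₁ T) n) ((YoungTab.col₂ T).erase n)}) ∧
    (∀ S, YoungTab.Lt le T S → S.length ≤ 2) ∧
    (∀ S ∈ YoungTab.cover le T, S.length ≤ 2 ∧
      (YoungTab.col₁ S).length = (YoungTab.col₁ T).length + 1 ∧
      (YoungTab.col₂ S).length + 1 = (YoungTab.col₂ T).length) := by
  have H : IsBalOrder le := by
    rcases hle with rfl | rfl
    · exact isBalOrder_dufloLE
    · exact isBalOrder_chainLE
  obtain ⟨A, B, hv, rfl⟩ := hT.1.exists_cols hT2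
  have hU : ∀ t, t ∈ A ∪ B ↔ 1 ≤ t ∧ t ≤ n := fun t => by
    rw [← mem_flatten_cols, hT.2.mem_iff, List.mem_range'_1]
    omega
  have hmax : ∀ t ∈ A ∪ B, t ≤ n := fun t ht => ((hU t).1 ht).2
  rw [hv.col₁_eq, hv.col₂_eq]
  refine ⟨fun hn => ?_, fun hn => ?_, fun S hS => ?_, fun S hS => ?_⟩
  · rw [Finset.mem_sort] at hn
    rw [proj_of_max hv (Finset.mem_union_left _ hn) hmax]
    exact ⟨H.lt_iff_of_max_mem_left hv hn hmax, H.cover_of_max_mem_left hv hn hmax⟩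
  · rw [Finset.mem_sort] at hn
    have hA : A.Nonempty := by
      rw [Finset.nonempty_iff_ne_empty]
      rintro hA
      simp [hv.right_eq_empty hA] at hn
    have h : MaxRight A B (A.max' hA) n :=
      ⟨hv, hn, hmax, A.max'_mem hA, fun t ht => A.le_max' t ht⟩
    -- Standardness enters here: all letters between the greatest first-column entry and `n` occur
    -- in the tableau.
    have hcons : ∀ t, A.max' hA < t → t ≤ n → t ∈ A ∪ B := fun t h1 h2 =>
      (hU t).2 ⟨by omega, h2⟩
    rw [proj_of_max hv (Finset.mem_union_right _ hn) hmax, Finset.erase_eq_of_notMem h.notMem,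
      h.deleteCorner, omega₁_cols hv h.left h.max_left, erase_sort, erase_sort,
      colAdd_sort h.notMem]
    exact ⟨H.lt_iff_of_max_mem_right h hcons, H.cover_of_max_mem_right h hcons⟩
  · obtain ⟨A', B', _, rfl, _⟩ := (H.lt_iff hv).1 hS
    exact cols_length_le A' B'
  · obtain ⟨A', B', hv', rfl, hb, hcard⟩ := (H.mem_cover_iff hv).1 hS
    have h1 : A.card + B.card = A'.card + B'.card := by
      rw [← Finset.card_union_of_disjoint hv.disj, hb.union,
        Finset.card_union_of_disjoint hv'.disj]
    rw [hv'.col₁_eq, hv'.col₂_eq]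
    simp only [Finset.length_sort]
    exact ⟨cols_length_le A' B', by omega, hcard⟩
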